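/- Let $K$ be an algebraically closed field of arbitrary characteristic, let $n\ge 4$, and let $X\subset\mathbb{P}^n$ be a smooth cubic hypersurface over $K$. For $x\in X$ let $F_1(X,x)$ be the subscheme of the Grassmannian $\mathbb{G}(1,n)$ that parametrises the lines $L$ with $x\in L\subset X$. Call $x\in X$ an Eckardt point if $X\cap T_xX$ is a cone with vertex $x$, where $T_xX\subset\mathbb{P}^n$ is the embedded tangent space of $X$ at $x$. Then there is a Zariski open subset $U\subset X$ such that: 1. for every $x\in U$ one has $\dim F_1(X,x)=n-4$; 2. for every $x\in X\setminus U$ the scheme $F_1(X,x)$ is nonempty and each of its irreducible components has dimension $n-3$; 3. $X\setminus U$ is exactly the set of Eckardt points of $X$. -/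

import Mathlib

open MvPolynomial
open scoped LinearAlgebra.Projectivization

namespace CubicLines

/-- A form of degree `d` satisfies `f(t v) = t ^ d f(v)`. -/
theorem eval_smul_of_isHomogeneous {K ι : Type*} [Field K] {f : MvPolynomial ι K} {d : ℕ}
    (hf : f.IsHomogeneous d) (t : K) (v : ι → K) :
    eval (t • v) f = t ^ d * eval v f := by
  classical
  rw [eval_eq, eval_eq, Finset.mul_sum]
  refine Finset.sum_congr rfl fun m hm => ?_
  have hd : ∑ i ∈ m.support, m i = d := by
    have h := hf (mem_support_iff.mp hm)
    rw [Finsupp.weight_apply, Finsupp.sum] at h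
    simpa using h
  simp only [Pi.smul_apply, smul_eq_mul, mul_pow, Finset.prod_mul_distrib,
    Finset.prod_pow_eq_pow_sum, hd]
  ring

/-- The common zero locus, in projective space, of a set of polynomials. It is only used for
sets of homogeneous polynomials; for these the choice of homogeneous coordinates `x.rep` does not
matter. -/
def zeroLocus {K ι : Type*} [Field K] (S : Set (MvPolynomial ι K)) : Set (ℙ K (ι → K)) :=
  {x | ∀ f ∈ S, eval x.rep f = 0}

/-- For a form, vanishing at a point may be tested on any homogeneous coordinate vector. -/
theorem eval_rep_mk_eq_zero_iff {K ι : Type*} [Field K] {f : MvPolynomial ι K} {d : ℕ}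
    (hf : f.IsHomogeneous d) (v : ι → K) (hv : v ≠ 0) :
    eval (Projectivization.mk K v hv).rep f = 0 ↔ eval v f = 0 := by
  obtain ⟨a, ha⟩ := Projectivization.exists_smul_eq_mk_rep K v hv
  rw [← ha, Units.smul_def, eval_smul_of_isHomogeneous hf]
  simp

/-- The Zariski topology on projective space: the closed sets are the common zero loci of sets of
homogeneous polynomials (of possibly different degrees). -/
instance zariskiTopology (K ι : Type*) [Field K] : TopologicalSpace (ℙ K (ι → K)) :=
  TopologicalSpace.ofClosed
    {T | ∃ S : Set (MvPolynomial ι K), (∀ f ∈ S, ∃ d : ℕ, f.IsHomogeneous d) ∧ T = zeroLocus S}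
    (by
      refine ⟨{1}, ?_, ?_⟩
      · rintro f rfl
        exact ⟨0, isHomogeneous_one ι K⟩
      · ext x
        simp [zeroLocus])
    (by
      intro A hA
      refine ⟨{f | (∃ d : ℕ, f.IsHomogeneous d) ∧ ∃ T ∈ A, ∀ x ∈ T, eval x.rep f = 0}, ?_, ?_⟩
      · exact fun f hf => hf.1
      · ext x
        constructor
        · rintro hx f ⟨-, T, hT, hfT⟩
          exact hfT x (hx T hT)
        · intro hx T hT
          obtain ⟨S, hS, rfl⟩ := hA hT
          intro f hf
          exact hx f ⟨hS f hf, _, hT, fun y hy => hy f hf⟩)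
    (by
      rintro _ ⟨S, hS, rfl⟩ _ ⟨S', hS', rfl⟩
      refine ⟨{h | ∃ f ∈ S, ∃ g ∈ S', h = f * g}, ?_, ?_⟩
      · rintro _ ⟨f, hf, g, hg, rfl⟩
        obtain ⟨d, hd⟩ := hS f hf
        obtain ⟨e, he⟩ := hS' g hg
        exact ⟨d + e, hd.mul he⟩
      · ext x
        constructor
        · rintro (hx | hx) _ ⟨f, hf, g, hg, rfl⟩
          · simp [hx f hf]
          · simp [hx g hg]
        · intro hx
          by_contra hcon
          obtain ⟨h1, h2⟩ := not_or.mp hcon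
          obtain ⟨f, hf, hfx⟩ : ∃ f, ∃ _ : f ∈ S, eval x.rep f ≠ 0 := by
            by_contra hno
            push Not at hno
            exact h1 hno
          obtain ⟨g, hg, hgx⟩ : ∃ g, ∃ _ : g ∈ S', eval x.rep g ≠ 0 := by
            by_contra hno
            push Not at hno
            exact h2 hno
          have := hx (f * g) ⟨f, hf, g, hg, rfl⟩
          rw [map_mul, mul_eq_zero] at this
          exact this.elim hfx hgx)

/-- The set `𝔾(1, n)` of lines in `ℙⁿ`: the two-dimensional linear subspaces of `Kⁿ⁺¹`. -/
def Line (K : Type*) [Field K] (n : ℕ) : Type _ :=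
  {L : Submodule K (Fin (n + 1) → K) // Module.finrank K L = 2}

/-- The point `x` lies on the line `L`. -/
def Line.Contains {K : Type*} [Field K] {n : ℕ} (L : Line K n) (x : ℙ K (Fin (n + 1) → K)) : Prop :=
  x.submodule ≤ L.1

/-- The Plücker coordinates `u i * v j - u j * v i` of a pair of vectors. All pairs `(i, j)` are
used: this realises `⋀² Kⁿ⁺¹` as the space of alternating matrices. -/
def pluckerVec {K : Type*} [Field K] {n : ℕ} (u v : Fin (n + 1) → K) :
    Fin (n + 1) × Fin (n + 1) → K :=
  fun p => u p.1 * v p.2 - u p.2 * v p.1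

theorem pluckerVec_ne_zero {K : Type*} [Field K] {n : ℕ} {u v : Fin (n + 1) → K}
    (h : LinearIndependent K ![u, v]) : pluckerVec u v ≠ 0 := by
  intro h0
  have hp : ∀ i j, u i * v j - u j * v i = 0 := fun i j => congrFun h0 (i, j)
  rw [LinearIndependent.pair_iff] at h
  have hu : u ≠ 0 := by
    rintro rfl
    exact one_ne_zero (h 1 0 (by simp)).1
  obtain ⟨i, hi⟩ := Function.ne_iff.mp hu
  refine hi (h (-v i) (u i) ?_).2
  funext j
  have := hp i j
  simp only [Pi.add_apply, Pi.smul_apply, smul_eq_mul, Pi.zero_apply]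
  linear_combination this

/-- A basis of the plane in `Kⁿ⁺¹` underlying a line. -/
noncomputable def Line.basis {K : Type*} [Field K] {n : ℕ} (L : Line K n) :
    Module.Basis (Fin 2) K L.1 :=
  Module.finBasisOfFinrankEq K L.1 L.2

theorem Line.linearIndependent_basis {K : Type*} [Field K] {n : ℕ} (L : Line K n) :
    LinearIndependent K ![(L.basis 0 : Fin (n + 1) → K), (L.basis 1 : Fin (n + 1) → K)] := by
  have h := L.basis.linearIndependent.map' L.1.subtype (Submodule.ker_subtype _)
  have e : ![(L.basis 0 : Fin (n + 1) → K), (L.basis 1 : Fin (n + 1) → K)] =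
      L.1.subtype ∘ L.basis := by
    funext i
    fin_cases i <;> rfl
  rw [e]
  exact h

/-- The Plücker embedding of `𝔾(1, n)` into projective space. -/
noncomputable def Line.plucker {K : Type*} [Field K] {n : ℕ} (L : Line K n) :
    ℙ K (Fin (n + 1) × Fin (n + 1) → K) :=
  Projectivization.mk K (pluckerVec (L.basis 0 : Fin (n + 1) → K) (L.basis 1 : Fin (n + 1) → K))
    (pluckerVec_ne_zero L.linearIndependent_basis)

/-- The Plücker point of a line can be computed from any two vectors spanning it. -/
theorem Line.plucker_eq {K : Type*} [Field K] {n : ℕ} (L : Line K n) {u v : Fin (n + 1) → K}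
    (hu : u ∈ L.1) (hv : v ∈ L.1) (h : LinearIndependent K ![u, v]) :
    L.plucker = Projectivization.mk K (pluckerVec u v) (pluckerVec_ne_zero h) := by
  symm
  rw [Line.plucker, Projectivization.mk_eq_mk_iff']
  have eu := congrArg Subtype.val (L.basis.sum_repr ⟨u, hu⟩)
  have ev := congrArg Subtype.val (L.basis.sum_repr ⟨v, hv⟩)
  simp only [Fin.sum_univ_two, Submodule.coe_add, Submodule.coe_smul] at eu ev
  refine ⟨L.basis.repr ⟨u, hu⟩ 0 * L.basis.repr ⟨v, hv⟩ 1 -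
    L.basis.repr ⟨u, hu⟩ 1 * L.basis.repr ⟨v, hv⟩ 0, ?_⟩
  funext p
  have eu1 := congrFun eu p.1
  have eu2 := congrFun eu p.2
  have ev1 := congrFun ev p.1
  have ev2 := congrFun ev p.2
  simp only [Pi.add_apply, Pi.smul_apply, smul_eq_mul] at eu1 eu2 ev1 ev2
  simp only [pluckerVec, Pi.smul_apply, smul_eq_mul]
  rw [← eu1, ← eu2, ← ev1, ← ev2]
  ring

/-- The Zariski topology on `𝔾(1, n)`, induced by the Plücker embedding. -/
noncomputable instance lineTopology (K : Type*) [Field K] (n : ℕ) : TopologicalSpace (Line K n) :=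
  TopologicalSpace.induced Line.plucker (zariskiTopology K (Fin (n + 1) × Fin (n + 1)))

/-- The hypersurface `V(F)` in `ℙⁿ`. -/
def hypersurface {K : Type*} [Field K] {n : ℕ} (F : MvPolynomial (Fin (n + 1)) K) :
    Set (ℙ K (Fin (n + 1) → K)) :=
  zeroLocus {F}

/-- Smoothness of the hypersurface `V(F)` (Jacobian criterion): at every point of `V(F)` some
partial derivative of `F` is nonzero. -/
def IsSmooth {K : Type*} [Field K] {n : ℕ} (F : MvPolynomial (Fin (n + 1)) K) : Prop :=
  ∀ x ∈ hypersurface F, ∃ i, eval x.rep (pderiv i F) ≠ 0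

/-- `F₁(X, x)`: the lines contained in `X` and passing through `x`. -/
def linesThrough {K : Type*} [Field K] {n : ℕ} (X : Set (ℙ K (Fin (n + 1) → K)))
    (x : ℙ K (Fin (n + 1) → K)) : Set (Line K n) :=
  {L | (∀ y, L.Contains y → y ∈ X) ∧ L.Contains x}

/-- The embedded projective tangent space at `x` of the hypersurface `V(F)`. -/
def tangentSpace {K : Type*} [Field K] {n : ℕ} (F : MvPolynomial (Fin (n + 1)) K)
    (x : ℙ K (Fin (n + 1) → K)) : Set (ℙ K (Fin (n + 1) → K)) :=
  {y | ∑ i, eval x.rep (pderiv i F) * y.rep i = 0}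

/-- `C` is a cone with vertex `x`: it contains `x`, and with every other point `y` it contains the
line joining `x` and `y`. -/
def IsConeWithVertex {K : Type*} [Field K] {n : ℕ} (C : Set (ℙ K (Fin (n + 1) → K)))
    (x : ℙ K (Fin (n + 1) → K)) : Prop :=
  x ∈ C ∧ ∀ y ∈ C, ∀ z : ℙ K (Fin (n + 1) → K), z.submodule ≤ x.submodule ⊔ y.submodule → z ∈ C

/-- `x` is an Eckardt point of `X = V(F)`: `x ∈ X` and `X ∩ TₓX` is a cone with vertex `x`. -/
def IsEckardtPoint {K : Type*} [Field K] {n : ℕ} (F : MvPolynomial (Fin (n + 1)) K)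
    (x : ℙ K (Fin (n + 1) → K)) : Prop :=
  x ∈ hypersurface F ∧ IsConeWithVertex (hypersurface F ∩ tangentSpace F x) x

end CubicLines

/-! Let `x` represent a point of `X = V(F)` and let `φ` parametrise a complement of `x` in the
kernel of `dF_x`, of dimension `n - 1`. On tangent vectors `F(s x + t φ w) = s t² q(w) + t³ c(w)`,
where `q(w) = dF_{φ w}(x)` and `c = F ∘ φ`. A line through `x` inside `X` is automatically tangent,
so these lines are the points of `V(q, c)` in `ℙⁿ⁻²` (`image_joinLine_eq_linesThrough`). With `x`
fixed, Plücker coordinates are linear in `w`, so the bijection is a homeomorphism. The point is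
Eckardt exactly when `q = 0`, and explicit quintic forms show that this is a closed condition.

The geometric input is `IsSmooth.exists_eval_ne_zero`: if `F` vanished on a linear space of vector
dimension `n - 1 ≥ 3`, the derivatives in two complementary directions would be two quadrics on it,
and a common zero would be a singular point. Hence `c ≠ 0`, so at an Eckardt point every component
of `V(c)` has dimension `n - 3`. If `q ≠ 0`, a common factor of `q` and `c` would again put such a
linear space into `X`; so there is none, and `V(q, c)` has dimension `n - 4`.

Dimensions are computed with homogeneous primes, which correspond to irreducible closed sets by the
Nullstellensatz. Lower bounds come from prime chains ending at the irrelevant ideal, which lose at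
most one step per equation; upper bounds come from heights. The expansion of `F` along a line
involves no factorials, so the characteristic plays no role. -/

/-! ### Chains of primes with a fixed last member. -/

section PrimeChains

/-- There is a chain of `k + 1` primes, starting above `I` and ending with `J`. -/
def Ideal.HasPrimeChain {R : Type*} [CommRing R] (I J : Ideal R) (k : ℕ) : Prop :=
  ∃ l : LTSeries (PrimeSpectrum R), l.length = k ∧ I ≤ l.head.asIdeal ∧ l.last.asIdeal = J

namespace Ideal.HasPrimeChain

variable {R : Type*} [CommRing R] {I J : Ideal R} {k : ℕ}

/-- In a Noetherian ring the chain can be replaced by one with the same ends and length whose second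
prime already contains `f`; dropping the first prime costs one step. This is the Krull-type input
for all lower bounds on dimension. -/
theorem sup_span_singleton [IsNoetherianRing R] (h : I.HasPrimeChain J (k + 1)) {f : R}
    (hf : f ∈ J) : (I ⊔ Ideal.span {f}).HasPrimeChain J k := by
  obtain ⟨l, hl, hI, rfl⟩ := h
  obtain ⟨q, hq1, hq, hhead, hlast⟩ := PrimeSpectrum.exist_ltSeries_mem_one_of_mem_last l hf
  have h0 : q.length ≠ 0 := by omega
  refine ⟨q.tail h0, by simp [RelSeries.tail_length]; omega, ?_, by rw [RelSeries.last_tail, hlast]⟩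
  rw [RelSeries.head_tail, sup_le_iff, Ideal.span_singleton_le_iff_mem]
  refine ⟨hI.trans ?_, hq1⟩
  rw [hhead]
  exact LTSeries.head_le q 1

theorem exists_minimalPrimes (h : I.HasPrimeChain J k) :
    ∃ P ∈ I.minimalPrimes, P.HasPrimeChain J k := by
  obtain ⟨l, hl, hI, hJ⟩ := h
  obtain ⟨P, hP, hle⟩ := Ideal.exists_minimalPrimes_le hI
  exact ⟨P, hP, l, hl, hle, hJ⟩

theorem lt (h : I.HasPrimeChain J (k + 1)) : I < J := by
  obtain ⟨l, hl, hI, rfl⟩ := h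
  refine hI.trans_lt ?_
  have : l.head < l.last := l.strictMono (by simp [Fin.lt_def, hl])
  exact this

end Ideal.HasPrimeChain

end PrimeChains

/-! ### Dimension theory of homogeneous ideals. -/

namespace MvPolynomial

attribute [local instance] MvPolynomial.gradedAlgebra

theorem mem_idealOfVars_iff_eval_zero {K : Type*} [Field K] {N : ℕ} {p : MvPolynomial (Fin N) K} :
    p ∈ idealOfVars (Fin N) K ↔ eval 0 p = 0 := by
  have h := mem_pow_idealOfVars_iff' (σ := Fin N) (R := K) 1 p
  rw [pow_one] at h
  have he : eval (0 : Fin N → K) p = coeff 0 p := by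
    rw [← constantCoeff_eq]
    exact RingHom.congr_fun eval_zero p
  rw [h, he]
  constructor
  · intro h
    exact h 0 (by simp)
  · intro h x hx
    have : x = 0 := (Finsupp.degree_eq_zero_iff x).mp (by simpa using hx)
    rwa [this]

theorem isPrime_idealOfVars (K : Type*) [Field K] (N : ℕ) : (idealOfVars (Fin N) K).IsPrime := by
  have : idealOfVars (Fin N) K = RingHom.ker (eval (0 : Fin N → K)) := by
    ext p
    rw [mem_idealOfVars_iff_eval_zero, RingHom.mem_ker]
  rw [this]
  exact RingHom.ker_isPrime _

/-- The chain consists of the kernels of the substitutions `g k` that kill the first `k` variables;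
`X k` separates consecutive kernels. -/
theorem hasPrimeChain_bot_idealOfVars (K : Type*) [Field K] (N : ℕ) :
    (⊥ : Ideal (MvPolynomial (Fin N) K)).HasPrimeChain (idealOfVars (Fin N) K) N := by
  let g : ℕ → MvPolynomial (Fin N) K →ₐ[K] MvPolynomial (Fin N) K := fun k =>
    aeval fun i => if (i : ℕ) < k then 0 else X i
  have hg : ∀ k l, k ≤ l → (g l).comp (g k) = g l := by
    intro k l hkl
    apply MvPolynomial.algHom_ext
    intro i
    simp only [g, AlgHom.comp_apply, aeval_X]
    split_ifs with h1 h2 h2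
    · simp
    · omega
    · simp [h2]
    · simp [h2]
  let P : ℕ → PrimeSpectrum (MvPolynomial (Fin N) K) := fun k =>
    ⟨RingHom.ker (g k), RingHom.ker_isPrime _⟩
  have hlt : ∀ k, k < N → P k < P (k + 1) := by
    intro k hk
    refine lt_of_le_of_ne ?_ ?_
    · intro p hp
      change g (k + 1) p = 0
      rw [← hg k (k + 1) (by omega), AlgHom.comp_apply, show g k p = 0 from hp, map_zero]
    · intro he
      have h1 : (X ⟨k, hk⟩ : MvPolynomial (Fin N) K) ∈ (P (k + 1)).asIdeal := by
        change g (k + 1) _ = 0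
        simp [g]
      rw [← he] at h1
      have h2 : g k (X ⟨k, hk⟩) = 0 := h1
      simp [g] at h2
  refine ⟨⟨N, fun i => P i, fun i => hlt i i.2⟩, rfl, bot_le, ?_⟩
  ext p
  change g N p = 0 ↔ _
  rw [mem_idealOfVars_iff_eval_zero]
  have : g N p = C (eval 0 p) := by
    have h : g N = (Algebra.ofId K _).comp (aeval (0 : Fin N → K)) := by
      apply MvPolynomial.algHom_ext
      intro i
      simp [g]
    rw [h]
    rfl
  rw [this, C_eq_zero]

/-- The homogeneous core of `P` is again prime and still contains `I`, so minimality forces it to be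
`P`. -/
theorem isHomogeneous_of_mem_minimalPrimes {K σ : Type*} [Field K] {I P : Ideal (MvPolynomial σ K)}
    (hI : I.IsHomogeneous (homogeneousSubmodule σ K)) (hP : P ∈ I.minimalPrimes) :
    P.IsHomogeneous (homogeneousSubmodule σ K) := by
  have hle := Ideal.toIdeal_homogeneousCore_le (homogeneousSubmodule σ K) P
  have h1 : I ≤ (P.homogeneousCore (homogeneousSubmodule σ K)).toIdeal := by
    rw [← hI.toIdeal_homogeneousCore_eq_self]
    exact Ideal.homogeneousCore_mono _ hP.1.2
  have h2 := hP.2 ⟨hP.1.1.homogeneousCore, h1⟩ hle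
  rw [le_antisymm h2 hle]
  exact (P.homogeneousCore _).isHomogeneous

/-- The homogeneous primes that contain `I` and are properly contained in the irrelevant ideal. -/
def relevantPrimes {K : Type*} [Field K] {N : ℕ} (I : Ideal (MvPolynomial (Fin N) K)) :
    Set (Ideal (MvPolynomial (Fin N) K)) :=
  {P | P.IsPrime ∧ P.IsHomogeneous (homogeneousSubmodule (Fin N) K) ∧ I ≤ P ∧
    P < idealOfVars (Fin N) K}

variable {K : Type*} [Field K] {N : ℕ}

/-- Trades a chain of arbitrary primes for a chain of homogeneous ones: cut `P` by a variable
outside it and pass to a minimal prime, which is homogeneous and keeps all but one step of the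
chain. One step is lost overall because the irrelevant ideal itself is not relevant. -/
theorem exists_ltSeries_relevantPrimes {I : Ideal (MvPolynomial (Fin N) K)} (k : ℕ) :
    ∀ P : Ideal (MvPolynomial (Fin N) K), P.IsPrime →
      P.IsHomogeneous (homogeneousSubmodule (Fin N) K) → I ≤ P →
      P.HasPrimeChain (idealOfVars (Fin N) K) (k + 1) →
      ∃ l : LTSeries (relevantPrimes I), l.length = k ∧ l.head.1 = P := by
  induction k with
  | zero =>
    intro P hP hhom hI h
    exact ⟨RelSeries.singleton _ ⟨P, hP, hhom, hI, h.lt⟩, rfl, rfl⟩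
  | succ k ih =>
    intro P hP hhom hI h
    obtain ⟨i, hi⟩ : ∃ i, X i ∉ P := by
      by_contra hcon
      push Not at hcon
      refine h.lt.not_ge (Ideal.span_le.mpr ?_)
      rintro _ ⟨i, rfl⟩
      exact hcon i
    obtain ⟨Q, hQ, hQc⟩ := (h.sup_span_singleton
      (Ideal.subset_span ⟨i, rfl⟩ : X i ∈ idealOfVars (Fin N) K)).exists_minimalPrimes
    have hXi : (Ideal.span {X i}).IsHomogeneous (homogeneousSubmodule (Fin N) K) := by
      apply Ideal.homogeneous_span
      rintro _ rfl
      exact ⟨1, isHomogeneous_X K i⟩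
    have hle : P ⊔ Ideal.span {X i} ≤ Q := hQ.1.2
    obtain ⟨l, hl, hhead⟩ := ih Q hQ.1.1
      (isHomogeneous_of_mem_minimalPrimes (hhom.sup hXi) hQ)
      (hI.trans (le_sup_left.trans hle)) hQc
    have hPQ : P < Q := by
      refine lt_of_le_of_ne (le_sup_left.trans hle) ?_
      rintro rfl
      exact hi (hle (le_sup_right (a := P) (Ideal.subset_span rfl)))
    have hrel : (⟨P, hP, hhom, hI, h.lt⟩ : relevantPrimes I) < l.head := by
      change P < l.head.1
      rwa [hhead]
    refine ⟨l.cons ⟨P, hP, hhom, hI, h.lt⟩ hrel, by simp [hl], by simp⟩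

/-- Heights grow by at least one along the chain, and the irrelevant ideal, of height at most `N`,
lies strictly above its last member. -/
theorem length_add_lt_of_le_height {I : Ideal (MvPolynomial (Fin N) K)} {h : ℕ}
    (hh : ∀ P ∈ relevantPrimes I, (h : ℕ∞) ≤ P.height) (l : LTSeries (relevantPrimes I)) :
    l.length + h < N := by
  have key : ∀ i (hi : i < l.length + 1), ((h + i : ℕ) : ℕ∞) ≤ (l ⟨i, hi⟩).1.height := by
    intro i
    induction i with
    | zero => intro hi; simpa using hh _ (l ⟨0, hi⟩).2
    | succ i ih =>
      intro hi
      have h1 := ih (by omega)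
      have h2 : (l ⟨i, by omega⟩).1 < (l ⟨i + 1, hi⟩).1 :=
        l.strictMono (by simp [Fin.lt_def])
      have := (l ⟨i, by omega⟩).2.1
      have := (l ⟨i + 1, hi⟩).2.1
      refine le_trans ?_ (Ideal.height_add_one_le_of_lt_of_isPrime h2)
      rw [← add_assoc, Nat.cast_add, Nat.cast_one]
      gcongr
  have h1 := key l.length (by omega)
  have h2 := (l ⟨l.length, by omega⟩).2.2.2.2
  have := (l ⟨l.length, by omega⟩).2.1
  have := isPrime_idealOfVars K N
  have h3 := Ideal.height_add_one_le_of_lt_of_isPrime h2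
  have h4 : ((idealOfVars (Fin N) K).height : WithBot ℕ∞) ≤ N := by
    refine Ideal.height_le_ringKrullDim_of_isPrime.trans ?_
    rw [MvPolynomial.ringKrullDim_of_isNoetherianRing, ringKrullDim_eq_zero_of_field]
    simp
  have h5 : ((h + l.length + 1 : ℕ) : ℕ∞) ≤ N := by
    rw [Nat.cast_add _ 1, Nat.cast_one]
    exact (add_le_add_left h1 1).trans (h3.trans (by exact_mod_cast h4))
  have : h + l.length + 1 ≤ N := by exact_mod_cast h5
  omega

theorem krullDim_relevantPrimes {I P : Ideal (MvPolynomial (Fin N) K)} {d h : ℕ}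
    (hN : d + h + 1 = N) (hh : ∀ P ∈ relevantPrimes I, (h : ℕ∞) ≤ P.height)
    (hP : P.IsPrime) (hhom : P.IsHomogeneous (homogeneousSubmodule (Fin N) K)) (hI : I ≤ P)
    (hc : P.HasPrimeChain (idealOfVars (Fin N) K) (d + 1)) :
    Order.krullDim (relevantPrimes I) = d := by
  refine le_antisymm ?_ ?_
  · refine iSup_le fun l => ?_
    have := length_add_lt_of_le_height hh l
    exact_mod_cast (by omega : l.length ≤ d)
  · obtain ⟨l, hl, -⟩ := exists_ltSeries_relevantPrimes d P hP hhom hI hc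
    rw [← hl]
    exact Order.LTSeries.length_le_krullDim l

/-- A generator of a homogeneous principal ideal is homogeneous. -/
theorem isHomogeneous_totalDegree_of_span_singleton {p : MvPolynomial (Fin N) K}
    (h : (Ideal.span {p}).IsHomogeneous (homogeneousSubmodule (Fin N) K)) :
    p.IsHomogeneous p.totalDegree := by
  by_cases hp : p = 0
  · rw [hp]; exact isHomogeneous_zero _ _ _
  have key : ∀ i, i ≠ p.totalDegree → homogeneousComponent i p = 0 := by
    intro i hi
    by_contra hne
    -- A nonzero component is a multiple of `p`, so its degree is at least that of `p`; above the
    -- total degree all components vanish.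
    obtain ⟨r, hr⟩ := Ideal.mem_span_singleton.mp
      (homogeneousComponent_mem_of_mem h (Ideal.mem_span_singleton_self p) i)
    have hr0 : r ≠ 0 := by
      rintro rfl
      exact hne (by rw [hr, mul_zero])
    have h1 := congrArg MvPolynomial.totalDegree hr
    rw [totalDegree_mul_of_isDomain hp hr0,
      (homogeneousComponent_isHomogeneous i p).totalDegree hne] at h1
    exact hne (homogeneousComponent_eq_zero i p (by omega))
  have h2 := sum_homogeneousComponent p
  rw [Finset.sum_eq_single_of_mem p.totalDegree (by simp) (fun i _ hi => key i hi)] at h2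
  rw [← h2]
  nth_rw 2 [h2]
  exact homogeneousComponent_isHomogeneous _ p

/-- By unique factorisation `P` contains a prime factor `p` of `f`; then `(p)` is a prime between
`(f)` and `P`, so it equals `P`. Homogeneity of `p` is inherited from `P`. -/
theorem exists_irreducible_of_mem_minimalPrimes {f : MvPolynomial (Fin N) K} {a : ℕ}
    (hf : f.IsHomogeneous a) (hf0 : f ≠ 0) {P : Ideal (MvPolynomial (Fin N) K)}
    (hP : P ∈ (Ideal.span {f}).minimalPrimes) :
    ∃ p d, p.IsHomogeneous d ∧ Irreducible p ∧ p ∣ f ∧ P = Ideal.span {p} := by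
  have hprime := hP.1.1
  have hfP : f ∈ P := hP.1.2 (Ideal.subset_span rfl)
  obtain ⟨p, hpP, hp⟩ : ∃ p ∈ P, Prime p ∧ p ∣ f := by
    obtain ⟨s, hs, u, hu⟩ := UniqueFactorizationMonoid.exists_prime_factors f hf0
    have h1 : s.prod ∈ P := by
      rw [← hu] at hfP
      exact (hprime.mem_or_mem hfP).resolve_right fun h =>
        hprime.ne_top (Ideal.eq_top_of_isUnit_mem _ h u.isUnit)
    obtain ⟨p, hps, hpP⟩ := (hprime.multiset_prod_mem_iff_exists_mem s).mp h1
    exact ⟨p, hpP, hs p hps, (Multiset.dvd_prod hps).trans ⟨u, hu.symm⟩⟩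
  have hpprime : (Ideal.span {p}).IsPrime :=
    (Ideal.span_singleton_prime hp.1.ne_zero).mpr hp.1
  have hle : Ideal.span {p} ≤ P := (Ideal.span_singleton_le_iff_mem P).mpr hpP
  have hPp : P = Ideal.span {p} := le_antisymm
    (hP.2 ⟨hpprime, Ideal.span_singleton_le_span_singleton.mpr hp.2⟩ hle) hle
  refine ⟨p, p.totalDegree, isHomogeneous_totalDegree_of_span_singleton ?_, hp.1.irreducible, hp.2, hPp⟩
  rw [← hPp]
  exact isHomogeneous_of_mem_minimalPrimes (Ideal.homogeneous_span _ _ (by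
    rintro _ rfl
    exact ⟨a, hf⟩)) hP

theorem hasPrimeChain_span_singleton {d : ℕ} (hN : N = d + 1) {f : MvPolynomial (Fin N) K}
    (hf : f ∈ idealOfVars (Fin N) K) :
    (Ideal.span {f}).HasPrimeChain (idealOfVars (Fin N) K) d := by
  have h : (⊥ : Ideal (MvPolynomial (Fin N) K)).HasPrimeChain (idealOfVars (Fin N) K) (d + 1) :=
    hN ▸ hasPrimeChain_bot_idealOfVars K N
  simpa using h.sup_span_singleton hf

theorem hasPrimeChain_span_pair {d : ℕ} (hN : N = d + 2) {f g : MvPolynomial (Fin N) K}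
    (hf : f ∈ idealOfVars (Fin N) K) (hg : g ∈ idealOfVars (Fin N) K) :
    (Ideal.span {f, g}).HasPrimeChain (idealOfVars (Fin N) K) d := by
  have h := (hasPrimeChain_span_singleton (d := d + 1) (by omega) hf).sup_span_singleton hg
  rwa [← Ideal.span_union, Set.union_singleton, Set.pair_comm] at h

theorem mem_idealOfVars_of_isHomogeneous {f : MvPolynomial (Fin N) K} {d : ℕ}
    (hf : f.IsHomogeneous d) (hd : d ≠ 0) : f ∈ idealOfVars (Fin N) K := by
  rw [mem_idealOfVars_iff_eval_zero]
  have h := RingHom.congr_fun (eval_zero (σ := Fin N) (R := K)) f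
  rw [h, constantCoeff_eq]
  exact hf.coeff_eq_zero (by simpa using hd.symm)

theorem IsHomogeneous.ne_zero_of_irreducible {p : MvPolynomial (Fin N) K} {d : ℕ}
    (hp : p.IsHomogeneous d) (hirr : Irreducible p) : d ≠ 0 := by
  rintro rfl
  have h := (totalDegree_eq_zero_iff_eq_C (p := p)).mp (Nat.le_zero.mp hp.totalDegree_le)
  refine hirr.not_isUnit ?_
  rw [h]
  refine IsUnit.map C (isUnit_iff_ne_zero.mpr fun h0 => hirr.ne_zero ?_)
  rw [h, h0, C_0]

theorem isHomogeneous_span {S : Set (MvPolynomial (Fin N) K)}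
    (hS : ∀ f ∈ S, ∃ d : ℕ, f.IsHomogeneous d) :
    (Ideal.span S).IsHomogeneous (homogeneousSubmodule (Fin N) K) :=
  Ideal.homogeneous_span _ _ hS

/-- The dimension of the intersection of two forms without a common factor. -/
theorem krullDim_relevantPrimes_pair {d : ℕ} (hN : N = d + 3) {f g : MvPolynomial (Fin N) K}
    {a b : ℕ} (hf : f.IsHomogeneous a) (hg : g.IsHomogeneous b) (ha : a ≠ 0) (hb : b ≠ 0)
    (hf0 : f ≠ 0) (hfg : ∀ p d, p.IsHomogeneous d → Irreducible p → p ∣ f → ¬ p ∣ g) :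
    Order.krullDim (relevantPrimes (Ideal.span {f, g})) = d := by
  have hhom : (Ideal.span {f, g}).IsHomogeneous (homogeneousSubmodule (Fin N) K) := by
    apply isHomogeneous_span
    rintro p (rfl | rfl)
    exacts [⟨a, hf⟩, ⟨b, hg⟩]
  obtain ⟨P, hP, hc⟩ := (hasPrimeChain_span_pair (d := d + 1) (by omega)
    (mem_idealOfVars_of_isHomogeneous hf ha)
    (mem_idealOfVars_of_isHomogeneous hg hb)).exists_minimalPrimes
  refine krullDim_relevantPrimes (h := 2) (by omega) ?_ hP.1.1
    (isHomogeneous_of_mem_minimalPrimes hhom hP) hP.1.2 hc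
  rintro P ⟨hP, hPhom, hI, -⟩
  have hfP : f ∈ P := hI (Ideal.subset_span (by simp))
  have hgP : g ∈ P := hI (Ideal.subset_span (by simp))
  obtain ⟨Q, hQ, hQP⟩ := Ideal.exists_minimalPrimes_le
    ((Ideal.span_singleton_le_iff_mem P).mpr hfP)
  have := hQ.1.1
  have hfQ : f ∈ Q := hQ.1.2 (Ideal.subset_span rfl)
  have hQhom := isHomogeneous_of_mem_minimalPrimes (isHomogeneous_span (by
    rintro p rfl
    exact ⟨a, hf⟩)) hQ
  obtain ⟨p, d, hpd, hp, hpf, rfl⟩ := exists_irreducible_of_mem_minimalPrimes hf hf0 hQ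
  -- Equality would make `p` divide `g` as well; strictness raises the height of `P` to at least
  -- two.
  have hlt : Ideal.span {p} < P := by
    refine lt_of_le_of_ne hQP ?_
    rintro rfl
    exact hfg p d hpd hp hpf (Ideal.mem_span_singleton.mp hgP)
  have h1 : (1 : ℕ∞) ≤ (Ideal.span {p}).height :=
    Ideal.one_le_height_span_singleton_of_mem_nonZeroDivisors
      (mem_nonZeroDivisors_of_ne_zero hp.ne_zero)
  refine le_trans ?_ (Ideal.height_add_one_le_of_lt_of_isPrime hlt)
  exact (add_le_add_left h1 1).trans' (by norm_num)

theorem krullDim_relevantPrimes_of_mem_minimalPrimes {d : ℕ} (hN : N = d + 2)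
    {f : MvPolynomial (Fin N) K} {a : ℕ} (hf : f.IsHomogeneous a) (hf0 : f ≠ 0)
    {P : Ideal (MvPolynomial (Fin N) K)} (hP : P ∈ (Ideal.span {f}).minimalPrimes) :
    Order.krullDim (relevantPrimes P) = d := by
  obtain ⟨p, b, hpb, hp, hpf, rfl⟩ := exists_irreducible_of_mem_minimalPrimes hf hf0 hP
  have hprime := hP.1.1
  have hb := hpb.ne_zero_of_irreducible hp
  refine krullDim_relevantPrimes (h := 1) (by omega) ?_ hprime
    (isHomogeneous_span (by rintro _ rfl; exact ⟨b, hpb⟩)) le_rfl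
    (hasPrimeChain_span_singleton (by omega) (mem_idealOfVars_of_isHomogeneous hpb hb))
  rintro Q ⟨-, -, hQ, -⟩
  exact (Ideal.one_le_height_span_singleton_of_mem_nonZeroDivisors
    (mem_nonZeroDivisors_of_ne_zero hp.ne_zero)).trans (Ideal.height_mono hQ)

end MvPolynomial

/-! ### Irreducible closed sets in projective space and homogeneous primes. -/

theorem Topology.IsInducing.isIrreducible_of_image {X Y : Type*} [TopologicalSpace X]
    [TopologicalSpace Y] {f : X → Y} (hf : Topology.IsInducing f) {s : Set X}
    (h : IsIrreducible (f '' s)) : IsIrreducible s := by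
  refine ⟨h.1.of_image, fun u v hu hv => ?_⟩
  obtain ⟨u', hu', rfl⟩ := hf.isOpen_iff.mp hu
  obtain ⟨v', hv', rfl⟩ := hf.isOpen_iff.mp hv
  rintro ⟨x, hx, hxu⟩ ⟨y, hy, hyv⟩
  obtain ⟨_, ⟨z, hz, rfl⟩, hzuv⟩ :=
    h.2 u' v' hu' hv' ⟨f x, ⟨x, hx, rfl⟩, hxu⟩ ⟨f y, ⟨y, hy, rfl⟩, hyv⟩
  exact ⟨z, hz, hzuv⟩

namespace CubicLines

attribute [local instance] MvPolynomial.gradedAlgebra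

theorem isClosed_iff {K ι : Type*} [Field K] {T : Set (ℙ K (ι → K))} :
    IsClosed T ↔ ∃ S : Set (MvPolynomial ι K), (∀ f ∈ S, ∃ d : ℕ, f.IsHomogeneous d) ∧
      T = zeroLocus S := by
  rw [← isOpen_compl_iff]
  change Tᶜᶜ ∈ _ ↔ _
  rw [compl_compl]
  rfl

theorem mk_mem_zeroLocus_iff {K ι : Type*} [Field K] {S : Set (MvPolynomial ι K)}
    (hS : ∀ f ∈ S, ∃ d : ℕ, f.IsHomogeneous d) {v : ι → K} (hv : v ≠ 0) :
    Projectivization.mk K v hv ∈ zeroLocus S ↔ ∀ f ∈ S, eval v f = 0 := by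
  refine forall₂_congr fun f hf => ?_
  obtain ⟨d, hd⟩ := hS f hf
  exact eval_rep_mk_eq_zero_iff hd v hv

theorem zeroLocus_span {K ι : Type*} [Field K] (S : Set (MvPolynomial ι K)) :
    zeroLocus (Ideal.span S : Set (MvPolynomial ι K)) = zeroLocus S := by
  ext x
  refine ⟨fun h f hf => h f (Ideal.subset_span hf), fun h f hf => ?_⟩
  have : Ideal.span S ≤ RingHom.ker (eval x.rep) := Ideal.span_le.mpr h
  exact this hf

variable {K : Type*} [Field K] {N : ℕ}

/-- The affine cone over a subset of projective space. -/
def cone (Z : Set (ℙ K (Fin N → K))) : Set (Fin N → K) :=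
  {v | ∀ h : v ≠ 0, Projectivization.mk K v h ∈ Z}

theorem smul_mem_cone {Z : Set (ℙ K (Fin N → K))} {v : Fin N → K} (hv : v ∈ cone Z) (t : K) :
    t • v ∈ cone Z := by
  intro h
  have ht : t ≠ 0 := by rintro rfl; exact h (zero_smul _ _)
  have hv0 : v ≠ 0 := by rintro rfl; exact h (smul_zero _)
  have : Projectivization.mk K (t • v) h = Projectivization.mk K v hv0 := by
    rw [Projectivization.mk_eq_mk_iff']
    exact ⟨t, rfl⟩
  rw [this]
  exact hv hv0

theorem zero_mem_cone (Z : Set (ℙ K (Fin N → K))) : (0 : Fin N → K) ∈ cone Z :=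
  fun h => absurd rfl h

/-- The homogeneous ideal of a subset of projective space. -/
def coneIdeal (Z : Set (ℙ K (Fin N → K))) : Ideal (MvPolynomial (Fin N) K) :=
  MvPolynomial.vanishingIdeal K (cone Z)

theorem mem_coneIdeal_iff {Z : Set (ℙ K (Fin N → K))} {p : MvPolynomial (Fin N) K} :
    p ∈ coneIdeal Z ↔ ∀ v ∈ cone Z, eval v p = 0 := by
  rw [coneIdeal, mem_vanishingIdeal_iff]
  simp [aeval_eq_eval]

theorem coneIdeal_anti {Z W : Set (ℙ K (Fin N → K))} (h : Z ⊆ W) : coneIdeal W ≤ coneIdeal Z :=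
  vanishingIdeal_anti_mono fun _ hv hv0 => h (hv hv0)

theorem coneIdeal_le (Z : Set (ℙ K (Fin N → K))) : coneIdeal Z ≤ idealOfVars (Fin N) K :=
  fun _ hp => mem_idealOfVars_iff_eval_zero.mpr (mem_coneIdeal_iff.mp hp 0 (zero_mem_cone Z))

/-- For `v` in the cone, `p(t v) = ∑ p_j(v) t ^ j` vanishes for all `t`; over an infinite field each
coefficient `p_j(v)` is then zero. -/
theorem isHomogeneous_coneIdeal [Infinite K] (Z : Set (ℙ K (Fin N → K))) :
    (coneIdeal Z).IsHomogeneous (homogeneousSubmodule (Fin N) K) := by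
  intro i p hp
  have hd : ((DirectSum.decompose (homogeneousSubmodule (Fin N) K) p i :
      homogeneousSubmodule (Fin N) K i) : MvPolynomial (Fin N) K) = homogeneousComponent i p :=
    decomposition.decompose'_apply p i
  rw [hd, mem_coneIdeal_iff]
  intro v hv
  let g : Polynomial K := ∑ j ∈ Finset.range (p.totalDegree + 1),
    Polynomial.C (eval v (homogeneousComponent j p)) * Polynomial.X ^ j
  have hg : g = 0 := by
    apply Polynomial.funext
    intro t
    rw [Polynomial.eval_zero, ← mem_coneIdeal_iff.mp hp _ (smul_mem_cone hv t)]
    conv_rhs => rw [← sum_homogeneousComponent p]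
    rw [map_sum, Polynomial.eval_finsetSum]
    refine Finset.sum_congr rfl fun j _ => ?_
    rw [eval_smul_of_isHomogeneous (homogeneousComponent_isHomogeneous j p)]
    rw [Polynomial.eval_mul, Polynomial.eval_C, Polynomial.eval_pow, Polynomial.eval_X, mul_comm]
  by_cases hi : i < p.totalDegree + 1
  · have := congrArg (fun q => Polynomial.coeff q i) hg
    simpa [g, Polynomial.finsetSum_coeff, Polynomial.coeff_C_mul, Polynomial.coeff_X_pow,
      Nat.lt_succ_iff.mp hi] using this
  · rw [homogeneousComponent_eq_zero i p (by omega), map_zero]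

/-- A closed set is determined by its ideal. -/
theorem mk_mem_iff_of_isClosed {Z : Set (ℙ K (Fin N → K))} (hZ : IsClosed Z) {v : Fin N → K}
    (hv : v ≠ 0) : Projectivization.mk K v hv ∈ Z ↔ ∀ f ∈ coneIdeal Z, eval v f = 0 := by
  refine ⟨fun h f hf => mem_coneIdeal_iff.mp hf v fun _ => h, fun h => ?_⟩
  obtain ⟨S, hS, rfl⟩ := isClosed_iff.mp hZ
  rw [mk_mem_zeroLocus_iff hS]
  intro f hf
  obtain ⟨i, hi⟩ := Function.ne_iff.mp hv
  -- The form `f` may be a nonzero constant, which does not vanish at the origin of the cone; the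
  -- factor `X i` repairs this and is nonzero at `v`.
  have : X i * f ∈ coneIdeal (zeroLocus S) := by
    rw [mem_coneIdeal_iff]
    intro w hw
    by_cases hw0 : w = 0
    · simp [hw0]
    · rw [map_mul, (mk_mem_zeroLocus_iff hS hw0).mp (hw hw0) f hf, mul_zero]
  have := h _ this
  rw [map_mul, eval_X, mul_eq_zero] at this
  exact this.resolve_left hi

theorem zeroLocus_coneIdeal [Infinite K] {Z : Set (ℙ K (Fin N → K))} (hZ : IsClosed Z) :
    zeroLocus (coneIdeal Z : Set (MvPolynomial (Fin N) K)) = Z := by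
  ext x
  have := mk_mem_iff_of_isClosed hZ x.rep_nonzero
  rw [Projectivization.mk_rep] at this
  rw [this]
  rfl

theorem mem_zeroLocus_iff_homogeneous {I : Ideal (MvPolynomial (Fin N) K)}
    (hI : I.IsHomogeneous (homogeneousSubmodule (Fin N) K)) (x : ℙ K (Fin N → K)) :
    x ∈ zeroLocus (I : Set (MvPolynomial (Fin N) K)) ↔
      x ∈ zeroLocus {f | f ∈ I ∧ ∃ d : ℕ, f.IsHomogeneous d} := by
  refine ⟨fun h f hf => h f hf.1, fun h f hf => ?_⟩
  rw [← sum_homogeneousComponent f, map_sum]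
  exact Finset.sum_eq_zero fun j _ =>
    h _ ⟨homogeneousComponent_mem_of_mem hI hf j, j, homogeneousComponent_isHomogeneous j f⟩

theorem isClosed_zeroLocus {I : Ideal (MvPolynomial (Fin N) K)}
    (hI : I.IsHomogeneous (homogeneousSubmodule (Fin N) K)) :
    IsClosed (zeroLocus (I : Set (MvPolynomial (Fin N) K))) :=
  isClosed_iff.mpr ⟨{f | f ∈ I ∧ ∃ d : ℕ, f.IsHomogeneous d}, fun _ hf => hf.2,
    Set.ext (mem_zeroLocus_iff_homogeneous hI)⟩

theorem mk_mem_zeroLocus_ideal_iff {I : Ideal (MvPolynomial (Fin N) K)}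
    (hI : I.IsHomogeneous (homogeneousSubmodule (Fin N) K)) {v : Fin N → K} (hv : v ≠ 0) :
    Projectivization.mk K v hv ∈ zeroLocus (I : Set (MvPolynomial (Fin N) K)) ↔
      ∀ f ∈ I, eval v f = 0 := by
  rw [mem_zeroLocus_iff_homogeneous hI, mk_mem_zeroLocus_iff fun _ hf => hf.2]
  refine ⟨fun h f hf => ?_, fun h f hf => h f hf.1⟩
  rw [← sum_homogeneousComponent f, map_sum]
  exact Finset.sum_eq_zero fun j _ =>
    h _ ⟨homogeneousComponent_mem_of_mem hI hf j, j, homogeneousComponent_isHomogeneous j f⟩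

/-- The projective Nullstellensatz for homogeneous primes. -/
theorem coneIdeal_zeroLocus [IsAlgClosed K] {P : Ideal (MvPolynomial (Fin N) K)} (hP : P.IsPrime)
    (hom : P.IsHomogeneous (homogeneousSubmodule (Fin N) K)) (hle : P ≤ idealOfVars (Fin N) K) :
    coneIdeal (zeroLocus (P : Set (MvPolynomial (Fin N) K))) = P := by
  have : cone (zeroLocus (P : Set (MvPolynomial (Fin N) K))) = MvPolynomial.zeroLocus K P := by
    ext v
    rw [mem_zeroLocus_iff]
    simp only [aeval_eq_eval]
    by_cases hv : v = 0
    · subst hv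
      exact ⟨fun _ p hp => mem_idealOfVars_iff_eval_zero.mp (hle hp), fun _ => zero_mem_cone _⟩
    · exact ⟨fun h => (mk_mem_zeroLocus_ideal_iff hom hv).mp (h hv),
        fun h _ => (mk_mem_zeroLocus_ideal_iff hom hv).mpr h⟩
  rw [coneIdeal, this, IsPrime.vanishingIdeal_zeroLocus]

/-- Every cone contains the origin, so the empty set yields the irrelevant ideal and not the unit
ideal. This is why relevant primes are required to be strictly smaller. -/
theorem coneIdeal_empty : coneIdeal (∅ : Set (ℙ K (Fin N → K))) = idealOfVars (Fin N) K := by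
  refine le_antisymm (coneIdeal_le _) fun p hp => mem_coneIdeal_iff.mpr fun v hv => ?_
  have : v = 0 := by
    by_contra h
    exact hv h
  rw [this]
  exact mem_idealOfVars_iff_eval_zero.mp hp

/-- Primality of a homogeneous ideal may be tested on forms: if `f * g` vanishes on `Z`, then `Z` is
covered by `V(f)` and `V(g)`, and irreducibility selects one of them. -/
theorem coneIdeal_mem_relevantPrimes [Infinite K] {I : Ideal (MvPolynomial (Fin N) K)}
    {Z : Set (ℙ K (Fin N → K))} (hZ : IsClosed Z) (hirr : IsIrreducible Z)
    (hI : Z ⊆ zeroLocus (I : Set (MvPolynomial (Fin N) K)))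
    (hom : I.IsHomogeneous (homogeneousSubmodule (Fin N) K)) (hle : I ≤ idealOfVars (Fin N) K) :
    coneIdeal Z ∈ relevantPrimes I := by
  have hlt : coneIdeal Z < idealOfVars (Fin N) K := by
    refine lt_of_le_of_ne (coneIdeal_le Z) fun he => ?_
    obtain ⟨x, hx⟩ := hirr.nonempty
    have h1 := zeroLocus_coneIdeal hZ
    rw [he, ← coneIdeal_empty (K := K) (N := N), zeroLocus_coneIdeal isClosed_empty] at h1
    rw [← h1] at hx
    exact hx
  refine ⟨?_, isHomogeneous_coneIdeal Z, ?_, hlt⟩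
  · refine (isHomogeneous_coneIdeal Z).isPrime_of_homogeneous_mem_or_mem
      (hlt.trans_le le_top).ne ?_
    rintro f g ⟨d, hf⟩ ⟨e, hg⟩ hfg
    have hc : ∀ p : MvPolynomial (Fin N) K, (∃ d : ℕ, p.IsHomogeneous d) →
        IsClosed (zeroLocus {p}) := fun p hp =>
      isClosed_iff.mpr ⟨{p}, by rintro _ rfl; exact hp, rfl⟩
    have hcov : Z ⊆ zeroLocus {f} ∪ zeroLocus {g} := by
      intro x hx
      have h := mem_coneIdeal_iff.mp hfg x.rep fun _ => by rwa [Projectivization.mk_rep]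
      rw [map_mul, mul_eq_zero] at h
      exact h.imp (by rintro h _ rfl; exact h) (by rintro h _ rfl; exact h)
    have hsub : ∀ p : MvPolynomial (Fin N) K, (∃ d : ℕ, p.IsHomogeneous d) →
        Z ⊆ zeroLocus {p} → p ∈ coneIdeal Z := by
      rintro p ⟨d, hp⟩ hZp
      have key : ∀ v : Fin N → K, v ≠ 0 → v ∈ cone Z → eval v p = 0 := fun v hv hvZ =>
        (mk_mem_zeroLocus_iff (by rintro _ rfl; exact ⟨d, hp⟩) hv).mp (hZp (hvZ hv)) p rfl
      refine mem_coneIdeal_iff.mpr fun v hv => ?_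
      by_cases hv0 : v = 0
      · obtain ⟨x, hx⟩ := hirr.nonempty
        have h1 := key x.rep x.rep_nonzero fun _ => by rwa [Projectivization.mk_rep]
        -- At the origin a form of positive degree vanishes for free; a constant form is zero
        -- because it vanishes at some point of `Z`.
        by_cases hd : d = 0
        · subst hd
          have h2 := totalDegree_eq_zero_iff_eq_C.mp (Nat.le_zero.mp hp.totalDegree_le)
          rw [h2, eval_C] at h1
          rw [h2, h1, C_0, map_zero]
        · rw [hv0]
          exact mem_idealOfVars_iff_eval_zero.mp (mem_idealOfVars_of_isHomogeneous hp hd)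
      · exact key v hv0 hv
    exact (isPreirreducible_iff_isClosed_union_isClosed.mp hirr.2 _ _ (hc f ⟨d, hf⟩)
      (hc g ⟨e, hg⟩) hcov).imp (hsub f ⟨d, hf⟩) (hsub g ⟨e, hg⟩)
  · intro f hf
    refine mem_coneIdeal_iff.mpr fun v hv => ?_
    by_cases hv0 : v = 0
    · rw [hv0]
      exact mem_idealOfVars_iff_eval_zero.mp (hle hf)
    · exact (mk_mem_zeroLocus_ideal_iff hom hv0).mp (hI (hv hv0)) f hf

/-- If `V(P)` is covered by closed `Z` and `W`, the product of their ideals lies in `P` by the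
Nullstellensatz, so one factor does, since `P` is prime. -/
theorem isIrreducible_zeroLocus [IsAlgClosed K] {I P : Ideal (MvPolynomial (Fin N) K)}
    (hP : P ∈ relevantPrimes I) :
    IsIrreducible (zeroLocus (P : Set (MvPolynomial (Fin N) K))) := by
  obtain ⟨hprime, hom, -, hlt⟩ := hP
  have hPI := coneIdeal_zeroLocus hprime hom hlt.le
  refine ⟨?_, isPreirreducible_iff_isClosed_union_isClosed.mpr fun Z W hZ hW hcov => ?_⟩
  · rw [Set.nonempty_iff_ne_empty]
    intro he
    rw [he, coneIdeal_empty] at hPI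
    exact hlt.ne hPI.symm
  · have hmul : coneIdeal Z * coneIdeal W ≤ P := by
      rw [← hPI]
      refine Ideal.mul_le.mpr fun f hf g hg => mem_coneIdeal_iff.mpr fun v hv => ?_
      by_cases hv0 : v = 0
      · rw [map_mul, hv0, mem_coneIdeal_iff.mp hf 0 (zero_mem_cone Z), zero_mul]
      · rw [map_mul, mul_eq_zero]
        exact (hcov (hv hv0)).imp (fun h => mem_coneIdeal_iff.mp hf v fun _ => h)
          (fun h => mem_coneIdeal_iff.mp hg v fun _ => h)
    have hsub : ∀ Y : Set (ℙ K (Fin N → K)), IsClosed Y → coneIdeal Y ≤ P →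
        zeroLocus (P : Set (MvPolynomial (Fin N) K)) ⊆ Y := by
      intro Y hY hle x hx
      rw [← zeroLocus_coneIdeal hY]
      exact fun f hf => hx f (hle hf)
    exact (hprime.mul_le.mp hmul).imp (hsub Z hZ) (hsub W hW)

variable {I : Ideal (MvPolynomial (Fin N) K)}

/-- The homogeneous prime of an irreducible closed subset of a projective variety. -/
noncomputable def primeOfIrreducible [IsAlgClosed K]
    (hom : I.IsHomogeneous (homogeneousSubmodule (Fin N) K)) (hle : I ≤ idealOfVars (Fin N) K)
    (Z : TopologicalSpace.IrreducibleCloseds (zeroLocus (I : Set (MvPolynomial (Fin N) K)))) :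
    (relevantPrimes I) :=
  ⟨coneIdeal (Subtype.val '' (Z : Set _)),
    coneIdeal_mem_relevantPrimes ((isClosed_zeroLocus hom).isClosedMap_subtype_val _ Z.isClosed)
      (Z.isIrreducible.image _ continuous_subtype_val.continuousOn)
      (Subtype.coe_image_subset _ _) hom hle⟩

/-- The irreducible closed subset of a projective variety given by a homogeneous prime. -/
noncomputable def irreducibleOfPrime [IsAlgClosed K] (P : relevantPrimes I) :
    TopologicalSpace.IrreducibleCloseds (zeroLocus (I : Set (MvPolynomial (Fin N) K))) where
  carrier := Subtype.val ⁻¹' zeroLocus (P.1 : Set (MvPolynomial (Fin N) K))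
  isIrreducible' := by
    have hsub : zeroLocus (P.1 : Set (MvPolynomial (Fin N) K)) ⊆
        Set.range (Subtype.val : zeroLocus (I : Set (MvPolynomial (Fin N) K)) → _) := by
      rw [Subtype.range_coe]
      exact fun x hx f hf => hx f (P.2.2.2.1 hf)
    have himg := isIrreducible_zeroLocus P.2
    rw [← Set.image_preimage_eq_of_subset hsub] at himg
    exact Topology.IsInducing.subtypeVal.isIrreducible_of_image himg
  isClosed' := (isClosed_zeroLocus P.2.2.1).preimage continuous_subtype_val

theorem image_irreducibleOfPrime [IsAlgClosed K] (P : relevantPrimes I) :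
    Subtype.val '' (irreducibleOfPrime P : Set (zeroLocus (I : Set (MvPolynomial (Fin N) K)))) =
      zeroLocus (P.1 : Set (MvPolynomial (Fin N) K)) :=
  Set.image_preimage_eq_of_subset (s := zeroLocus (P.1 : Set (MvPolynomial (Fin N) K)))
    fun x hx => ⟨⟨x, fun f hf => hx f (P.2.2.2.1 hf)⟩, rfl⟩

/-- Irreducible closed subsets of a projective variety correspond to homogeneous primes. -/
noncomputable def irreducibleClosedsEquiv [IsAlgClosed K]
    (hom : I.IsHomogeneous (homogeneousSubmodule (Fin N) K)) (hle : I ≤ idealOfVars (Fin N) K) :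
    TopologicalSpace.IrreducibleCloseds (zeroLocus (I : Set (MvPolynomial (Fin N) K))) ≃o
      (relevantPrimes I)ᵒᵈ where
  toFun Z := OrderDual.toDual (primeOfIrreducible hom hle Z)
  invFun P := irreducibleOfPrime (OrderDual.ofDual P)
  left_inv Z := by
    apply TopologicalSpace.IrreducibleCloseds.ext
    apply Set.image_injective.mpr Subtype.val_injective
    simp only [OrderDual.ofDual_toDual]
    rw [image_irreducibleOfPrime]
    exact zeroLocus_coneIdeal ((isClosed_zeroLocus hom).isClosedMap_subtype_val _ Z.isClosed)
  right_inv P := by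
    apply OrderDual.ofDual.injective
    apply Subtype.ext
    change coneIdeal (Subtype.val '' _) = _
    rw [image_irreducibleOfPrime]
    exact coneIdeal_zeroLocus P.2.1 P.2.2.1 P.2.2.2.2.le
  map_rel_iff' {Z W} := by
    refine ⟨fun h => ?_, fun h => coneIdeal_anti (Set.image_mono h)⟩
    replace h : (primeOfIrreducible hom hle W).1 ≤ (primeOfIrreducible hom hle Z).1 := h
    have key := fun Y : TopologicalSpace.IrreducibleCloseds
        (zeroLocus (I : Set (MvPolynomial (Fin N) K))) =>
      zeroLocus_coneIdeal ((isClosed_zeroLocus hom).isClosedMap_subtype_val _ Y.isClosed)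
    rw [← SetLike.coe_subset_coe, ← Set.image_subset_image_iff Subtype.val_injective,
      ← key Z, ← key W]
    exact fun x hx f hf => hx f (h hf)

theorem topologicalKrullDim_zeroLocus [IsAlgClosed K]
    (hom : I.IsHomogeneous (homogeneousSubmodule (Fin N) K)) (hle : I ≤ idealOfVars (Fin N) K) :
    topologicalKrullDim (zeroLocus (I : Set (MvPolynomial (Fin N) K))) =
      Order.krullDim (relevantPrimes I) := by
  rw [topologicalKrullDim, Order.krullDim_eq_of_orderIso (irreducibleClosedsEquiv hom hle),
    Order.krullDim_orderDual]

/-- A minimal prime of `I` below the prime of `Z` cuts out an irreducible closed set containing `Z`;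
maximality of the component makes the two primes equal. -/
theorem exists_minimalPrimes_of_mem_irreducibleComponents [IsAlgClosed K]
    (hom : I.IsHomogeneous (homogeneousSubmodule (Fin N) K)) (hle : I ≤ idealOfVars (Fin N) K)
    {Z : Set (zeroLocus (I : Set (MvPolynomial (Fin N) K)))} (hZ : Z ∈ irreducibleComponents _) :
    ∃ P ∈ I.minimalPrimes, topologicalKrullDim Z = Order.krullDim (relevantPrimes P) := by
  let Z' : TopologicalSpace.IrreducibleCloseds (zeroLocus (I : Set (MvPolynomial (Fin N) K))) :=
    ⟨Z, hZ.1, isClosed_of_mem_irreducibleComponents Z hZ⟩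
  let P := primeOfIrreducible hom hle Z'
  have hPmin : P.1 ∈ I.minimalPrimes := by
    obtain ⟨Q, hQ, hQP⟩ := @Ideal.exists_minimalPrimes_le _ _ I P.1 P.2.1 P.2.2.2.1
    have hQmem : Q ∈ relevantPrimes I := ⟨hQ.1.1, isHomogeneous_of_mem_minimalPrimes hom hQ,
      hQ.1.2, hQP.trans_lt P.2.2.2.2⟩
    have h1 : Z' ≤ irreducibleOfPrime ⟨Q, hQmem⟩ := by
      rw [← (irreducibleClosedsEquiv hom hle).le_iff_le]
      have : irreducibleClosedsEquiv hom hle (irreducibleOfPrime ⟨Q, hQmem⟩) =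
          OrderDual.toDual ⟨Q, hQmem⟩ :=
        (irreducibleClosedsEquiv hom hle).apply_symm_apply (OrderDual.toDual ⟨Q, hQmem⟩)
      rw [this]
      exact hQP
    have h2 : irreducibleOfPrime ⟨Q, hQmem⟩ ≤ Z' :=
      hZ.2 (irreducibleOfPrime ⟨Q, hQmem⟩).isIrreducible h1
    have h3 : P.1 = Q := by
      have := coneIdeal_zeroLocus hQmem.1 hQmem.2.1 hQmem.2.2.2.le
      rw [← image_irreducibleOfPrime ⟨Q, hQmem⟩, ← le_antisymm h1 h2] at this
      exact this
    rwa [h3]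
  refine ⟨P.1, hPmin, ?_⟩
  rw [← topologicalKrullDim_zeroLocus P.2.2.1 P.2.2.2.2.le]
  have himg : Subtype.val '' Z = zeroLocus (P.1 : Set (MvPolynomial (Fin N) K)) :=
    (zeroLocus_coneIdeal ((isClosed_zeroLocus hom).isClosedMap_subtype_val _ Z'.isClosed)).symm
  rw [← himg]
  exact (Topology.IsEmbedding.subtypeVal.homeomorphImage Z).isHomeomorph.topologicalKrullDim_eq _

theorem zeroLocus_nonempty_of_relevantPrimes [IsAlgClosed K] (h : (relevantPrimes I).Nonempty) :
    (zeroLocus (I : Set (MvPolynomial (Fin N) K))).Nonempty := by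
  obtain ⟨P, hP⟩ := h
  obtain ⟨x, hx⟩ := (isIrreducible_zeroLocus hP).nonempty
  exact ⟨x, fun f hf => hx f (hP.2.2.1 hf)⟩

/-- Two forms of positive degree in at least three variables have a common zero. -/
theorem exists_common_zero [IsAlgClosed K] (hN : 3 ≤ N) {f g : MvPolynomial (Fin N) K} {a b : ℕ}
    (hf : f.IsHomogeneous a) (hg : g.IsHomogeneous b) (ha : a ≠ 0) (hb : b ≠ 0) :
    ∃ v : Fin N → K, v ≠ 0 ∧ eval v f = 0 ∧ eval v g = 0 := by
  obtain ⟨d, rfl⟩ : ∃ d, N = (d + 1) + 2 := ⟨N - 3, by omega⟩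
  obtain ⟨P, hP, hc⟩ := (hasPrimeChain_span_pair rfl (mem_idealOfVars_of_isHomogeneous hf ha)
    (mem_idealOfVars_of_isHomogeneous hg hb)).exists_minimalPrimes
  have hPhom := isHomogeneous_of_mem_minimalPrimes (isHomogeneous_span (by
    rintro p (rfl | rfl)
    exacts [⟨a, hf⟩, ⟨b, hg⟩])) hP
  obtain ⟨x, hx⟩ := zeroLocus_nonempty_of_relevantPrimes
    (I := Ideal.span {f, g}) ⟨P, hP.1.1, hPhom, hP.1.2, hc.lt⟩
  exact ⟨x.rep, x.rep_nonzero, hx f (Ideal.subset_span (by simp)),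
    hx g (Ideal.subset_span (by simp))⟩

end CubicLines

/-! ### Linear pullback and linear embeddings of projective spaces. -/

namespace CubicLines

section Pullback

variable {K σ ι τ : Type*} [Field K] [Fintype σ] [DecidableEq σ]

/-- The pullback of a polynomial function along a linear map. -/
noncomputable def pullback (φ : (σ → K) →ₗ[K] (ι → K)) :
    MvPolynomial ι K →ₐ[K] MvPolynomial σ K :=
  aeval fun i => ∑ j, C (φ (Pi.single j 1) i) * X j

@[simp]
theorem eval_pullback (φ : (σ → K) →ₗ[K] (ι → K)) (f : MvPolynomial ι K) (v : σ → K) :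
    eval v (pullback φ f) = eval (φ v) f := by
  have h : ((aeval v : MvPolynomial σ K →ₐ[K] K).comp (pullback φ)) = aeval (φ v) := by
    apply MvPolynomial.algHom_ext
    intro i
    simp only [pullback, AlgHom.comp_apply, aeval_X, map_sum, map_mul, aeval_C]
    conv_rhs => rw [LinearMap.pi_apply_eq_sum_univ φ v]
    rw [Finset.sum_apply]
    refine Finset.sum_congr rfl fun j _ => ?_
    have : (Pi.single j 1 : σ → K) = fun k => if j = k then 1 else 0 := by
      funext k
      simp [Pi.single_apply, eq_comm]
    simp [this, mul_comm]
  have := AlgHom.congr_fun h f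
  simpa [aeval_eq_eval] using this

theorem isHomogeneous_pullback (φ : (σ → K) →ₗ[K] (ι → K)) {f : MvPolynomial ι K} {d : ℕ}
    (hf : f.IsHomogeneous d) : (pullback φ f).IsHomogeneous d := by
  have := hf.aeval (n := 1) (fun i => ∑ j, C (φ (Pi.single j 1) i) * (X j : MvPolynomial σ K))
    fun i => IsHomogeneous.sum _ _ _ fun j _ => isHomogeneous_C_mul_X _ _
  rwa [one_mul] at this

end Pullback

/-- An injective linear map induces an embedding of projective spaces. -/
theorem isEmbedding_map {K σ ι : Type*} [Field K] [Fintype σ] [DecidableEq σ] [Fintype ι]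
    [DecidableEq ι] (φ : (σ → K) →ₗ[K] (ι → K)) (hφ : Function.Injective φ) :
    Topology.IsEmbedding (Projectivization.map φ hφ) := by
  -- Pulling forms back along a left inverse `π` extends equations from the source to the target.
  obtain ⟨π, hπ⟩ := φ.exists_leftInverse_of_injective (LinearMap.ker_eq_bot.mpr hφ)
  have hπ' : ∀ v, π (φ v) = v := fun v => LinearMap.congr_fun hπ v
  refine ⟨⟨?_⟩, Projectivization.map_injective φ hφ⟩
  refine TopologicalSpace.ext_isClosed fun T => ?_
  rw [isClosed_induced_iff, isClosed_iff]
  constructor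
  · rintro ⟨S, hS, rfl⟩
    have hS' : ∀ f ∈ pullback π '' S, ∃ d : ℕ, f.IsHomogeneous d := by
      rintro _ ⟨f, hf, rfl⟩
      obtain ⟨d, hd⟩ := hS f hf
      exact ⟨d, isHomogeneous_pullback π hd⟩
    refine ⟨zeroLocus (pullback π '' S), isClosed_iff.mpr ⟨_, hS', rfl⟩, ?_⟩
    ext x
    induction x using Projectivization.ind with | h v hv => ?_
    rw [Set.mem_preimage, Projectivization.map_mk, mk_mem_zeroLocus_iff hS',
      mk_mem_zeroLocus_iff hS]
    simp [hπ']
  · rintro ⟨T', hT', rfl⟩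
    obtain ⟨S, hS, rfl⟩ := isClosed_iff.mp hT'
    have hS' : ∀ f ∈ pullback φ '' S, ∃ d : ℕ, f.IsHomogeneous d := by
      rintro _ ⟨f, hf, rfl⟩
      obtain ⟨d, hd⟩ := hS f hf
      exact ⟨d, isHomogeneous_pullback φ hd⟩
    refine ⟨pullback φ '' S, hS', ?_⟩
    ext x
    induction x using Projectivization.ind with | h v hv => ?_
    rw [Set.mem_preimage, Projectivization.map_mk, mk_mem_zeroLocus_iff hS',
      mk_mem_zeroLocus_iff hS]
    simp

/-! ### Directional derivatives and the expansion of a cubic along a line. -/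

section DirectionalDerivative

variable {K ι : Type*} [Field K] [Fintype ι]

/-- The polynomial `∑ i, v i * ∂F/∂xᵢ`. -/
noncomputable def polar (F : MvPolynomial ι K) (v : ι → K) : MvPolynomial ι K :=
  ∑ i, C (v i) * pderiv i F

theorem isHomogeneous_polar {F : MvPolynomial ι K} {d : ℕ} (hF : F.IsHomogeneous d) (v : ι → K) :
    (polar F v).IsHomogeneous (d - 1) :=
  IsHomogeneous.sum _ _ _ fun _ _ => hF.pderiv.C_mul _

/-- The derivative of `F` at `x` as a linear form. -/
noncomputable def differential (F : MvPolynomial ι K) (x : ι → K) : (ι → K) →ₗ[K] K :=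
  ∑ i, eval x (pderiv i F) • LinearMap.proj i

theorem differential_apply (F : MvPolynomial ι K) (x v : ι → K) :
    differential F x v = ∑ i, eval x (pderiv i F) * v i := by
  simp [differential]

theorem eval_polar (F : MvPolynomial ι K) (x v : ι → K) :
    eval x (polar F v) = differential F x v := by
  simp [polar, differential_apply, mul_comm]

theorem differential_mul (F G : MvPolynomial ι K) (x v : ι → K) :
    differential (F * G) x v = eval x F * differential G x v + eval x G * differential F x v := by
  simp only [differential_apply, Finset.mul_sum, ← Finset.sum_add_distrib]
  refine Finset.sum_congr rfl fun i _ => ?_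
  rw [Derivation.leibniz]
  simp only [map_add, smul_eq_mul, map_mul]
  ring

theorem differential_add (F G : MvPolynomial ι K) (x v : ι → K) :
    differential (F + G) x v = differential F x v + differential G x v := by
  simp only [differential_apply, ← Finset.sum_add_distrib]
  refine Finset.sum_congr rfl fun i _ => ?_
  simp only [map_add]
  ring

theorem differential_smul_left {F : MvPolynomial ι K} {d : ℕ} (hF : F.IsHomogeneous d) (t : K)
    (x v : ι → K) : differential F (t • x) v = t ^ (d - 1) * differential F x v := by
  rw [← eval_polar, ← eval_polar, eval_smul_of_isHomogeneous (isHomogeneous_polar hF v)]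

theorem differential_self {F : MvPolynomial ι K} {d : ℕ} (hF : F.IsHomogeneous d) (x : ι → K) :
    differential F x x = d * eval x F := by
  have := congrArg (eval x) hF.sum_X_mul_pderiv
  simpa [differential_apply, mul_comm] using this

theorem differential_linear {F : MvPolynomial ι K} (hF : F.IsHomogeneous 1) (x v : ι → K) :
    differential F x v = eval v F := by
  have h : F ∈ homogeneousSubmodule ι K 1 := hF
  clear hF
  rw [homogeneousSubmodule_one_eq_span_X] at h
  classical
  induction h using Submodule.span_induction with
  | mem p hp =>
    obtain ⟨i, rfl⟩ := hp
    simp [differential_apply, pderiv_X, Pi.single_apply]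
  | zero => simp [differential_apply]
  | add p q _ _ hp hq =>
    rw [differential_add, hp, hq, map_add]
  | smul a p _ hp =>
    rw [smul_eval, ← hp]
    simp [differential_apply, Finset.mul_sum, mul_assoc]

theorem eval_smul_add_smul_linear {F : MvPolynomial ι K} (hF : F.IsHomogeneous 1) (s t : K)
    (x v : ι → K) : eval (s • x + t • v) F = s * eval x F + t * eval v F := by
  rw [← differential_linear hF 0, map_add, map_smul, map_smul, differential_linear hF,
    differential_linear hF, smul_eq_mul, smul_eq_mul]

/-- The expansion of a cubic form along a line. -/
theorem eval_smul_add_smul {F : MvPolynomial ι K} (hF : F.IsHomogeneous 3) (s t : K)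
    (x v : ι → K) : eval (s • x + t • v) F = s ^ 3 * eval x F + s ^ 2 * t * differential F x v +
      s * t ^ 2 * differential F v x + t ^ 3 * eval v F := by
  have h : F ∈ homogeneousSubmodule ι K 3 := hF
  clear hF
  -- The identity is additive in `F`, so it suffices to check products of three linear forms. No
  -- division occurs, hence it holds in every characteristic.
  rw [← homogeneousSubmodule_one_pow, pow_succ] at h
  induction h using Submodule.mul_induction_on' with
  | mem_mul_mem p hp c hc =>
    rw [pow_two] at hp
    induction hp using Submodule.mul_induction_on' with
    | mem_mul_mem a ha b hb =>
      have ha : a.IsHomogeneous 1 := ha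
      have hb : b.IsHomogeneous 1 := hb
      have hc : c.IsHomogeneous 1 := hc
      simp only [differential_mul, map_mul, differential_linear ha, differential_linear hb,
        differential_linear hc, eval_smul_add_smul_linear ha, eval_smul_add_smul_linear hb,
        eval_smul_add_smul_linear hc]
      ring
    | add p _ q _ hp hq =>
      rw [add_mul]
      simp only [differential_add, map_add, hp, hq]
      ring
  | add p _ q _ hp hq =>
    simp only [differential_add, map_add, hp, hq]
    ring

end DirectionalDerivative

end CubicLines

/-! ### The lines through a point as a projective zero locus. -/

namespace CubicLines

attribute [local instance] MvPolynomial.gradedAlgebra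

section LinesThroughPoint

variable {K : Type*} [Field K] {n : ℕ}

theorem mk_mem_hypersurface_iff {F : MvPolynomial (Fin (n + 1)) K} {d : ℕ} (hF : F.IsHomogeneous d)
    {v : Fin (n + 1) → K} (hv : v ≠ 0) :
    Projectivization.mk K v hv ∈ hypersurface F ↔ eval v F = 0 := by
  rw [hypersurface, mk_mem_zeroLocus_iff (by rintro _ rfl; exact ⟨d, hF⟩)]
  simp

theorem rep_mem_hypersurface_iff {F : MvPolynomial (Fin (n + 1)) K} {x : ℙ K (Fin (n + 1) → K)} :
    x ∈ hypersurface F ↔ eval x.rep F = 0 := by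
  simp [hypersurface, zeroLocus]

theorem mem_tangentSpace_iff {F : MvPolynomial (Fin (n + 1)) K} {x y : ℙ K (Fin (n + 1) → K)} :
    y ∈ tangentSpace F x ↔ differential F x.rep y.rep = 0 := by
  rw [differential_apply]
  rfl

theorem exists_eq_smul_rep {V : Type*} [AddCommGroup V] [Module K V] (v : V) (hv : v ≠ 0) :
    ∃ a : K, a ≠ 0 ∧ v = a • (Projectivization.mk K v hv).rep := by
  obtain ⟨a, ha⟩ := Projectivization.exists_smul_eq_mk_rep K v hv
  refine ⟨(a⁻¹ : Kˣ), Units.ne_zero _, ?_⟩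
  rw [← ha, Units.smul_def, smul_smul, Units.inv_mul, one_smul]

theorem mk_mem_tangentSpace_iff {F : MvPolynomial (Fin (n + 1)) K} {x : ℙ K (Fin (n + 1) → K)}
    {v : Fin (n + 1) → K} (hv : v ≠ 0) :
    Projectivization.mk K v hv ∈ tangentSpace F x ↔ differential F x.rep v = 0 := by
  rw [mem_tangentSpace_iff]
  obtain ⟨a, ha, hav⟩ := exists_eq_smul_rep (K := K) v hv
  conv_rhs => rw [hav, map_smul, smul_eq_mul, mul_eq_zero, or_iff_right ha]

/-- Two vectors outside each other's span determine a line. -/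
theorem finrank_span_pair {V : Type*} [AddCommGroup V] [Module K V] {u v : V}
    (h : LinearIndependent K ![u, v]) : Module.finrank K (Submodule.span K {u, v}) = 2 := by
  have := finrank_span_eq_card h
  rwa [Matrix.range_cons, Matrix.range_cons, Matrix.range_empty, Set.union_empty,
    Set.singleton_union, Fintype.card_fin] at this

variable {N : ℕ} (φ : (Fin N → K) →ₗ[K] (Fin (n + 1) → K)) (x : Fin (n + 1) → K)

/-- `φ` parametrises a complement of a line spanned by `x`. -/
def IsComplementary : Prop :=
  ∀ (s : K) (w : Fin N → K), s • x + φ w = 0 → s = 0 ∧ w = 0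

variable {φ x}

theorem IsComplementary.linearIndependent (h : IsComplementary φ x) {w : Fin N → K} (hw : w ≠ 0) :
    LinearIndependent K ![x, φ w] := by
  rw [LinearIndependent.pair_iff]
  intro s t hst
  obtain ⟨h1, h2⟩ := h s (t • w) (by rw [map_smul, hst])
  exact ⟨h1, (smul_eq_zero.mp h2).resolve_right hw⟩

/-- The line joining a fixed point `x` to the point `φ w`. -/
def joinLine (h : IsComplementary φ x) (w : ℙ K (Fin N → K)) : Line K n :=
  ⟨Submodule.span K {x, φ w.rep}, finrank_span_pair (h.linearIndependent w.rep_nonzero)⟩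

variable (φ x) in
/-- The linear map underlying the Plücker coordinates of the lines through `x`. -/
def pluckerMap : (Fin N → K) →ₗ[K] (Fin (n + 1) × Fin (n + 1) → K) where
  toFun w := pluckerVec x (φ w)
  map_add' u v := by
    funext p
    simp only [pluckerVec, map_add, Pi.add_apply]
    ring
  map_smul' a v := by
    funext p
    simp only [pluckerVec, map_smul, Pi.smul_apply, smul_eq_mul, RingHom.id_apply]
    ring

theorem pluckerMap_injective (h : IsComplementary φ x) : Function.Injective (pluckerMap φ x) := by
  rw [← LinearMap.ker_eq_bot, LinearMap.ker_eq_bot']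
  intro w hw
  by_contra hw0
  exact pluckerVec_ne_zero (h.linearIndependent hw0) hw

theorem plucker_joinLine (h : IsComplementary φ x) (w : ℙ K (Fin N → K)) :
    (joinLine h w).plucker = Projectivization.map (pluckerMap φ x) (pluckerMap_injective h) w := by
  rw [Line.plucker_eq (joinLine h w) (u := x) (v := φ w.rep)
    (Submodule.subset_span (by simp)) (Submodule.subset_span (by simp))
    (h.linearIndependent w.rep_nonzero)]
  conv_rhs => rw [← w.mk_rep, Projectivization.map_mk]
  rfl

/-- After the Plücker map, which induces the topology on lines, `joinLine` becomes the
projectivisation of an injective linear map. -/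
theorem isEmbedding_joinLine (h : IsComplementary φ x) :
    Topology.IsEmbedding (joinLine h) := by
  have h1 : Line.plucker ∘ joinLine h =
      Projectivization.map (pluckerMap φ x) (pluckerMap_injective h) :=
    funext (plucker_joinLine h)
  have h2 := isEmbedding_map (pluckerMap φ x) (pluckerMap_injective h)
  have h3 : Topology.IsInducing (Line.plucker (K := K) (n := n)) := ⟨rfl⟩
  rw [← h1] at h2
  exact ⟨h3.of_comp_iff.mp h2.isInducing, h2.injective.of_comp⟩

/-- This is the part of `F(s x + u)` left over when `F(x) = F(u) = 0`; a scalar other than 0 and 1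
separates the coefficients. -/
theorem eq_zero_of_cubic_coeffs [Infinite K] {a b : K} (h : ∀ s : K, s ^ 2 * a + s * b = 0) :
    a = 0 ∧ b = 0 := by
  classical
  obtain ⟨s, hs⟩ := Infinite.exists_notMem_finset ({0, 1} : Finset K)
  simp only [Finset.mem_insert, Finset.mem_singleton, not_or] at hs
  have h1 := h 1
  have h2 := h s
  have h3 : s * (s - 1) * a = 0 := by linear_combination h2 - s * h1
  have ha : a = 0 := by
    simpa [hs.1, sub_eq_zero, hs.2] using h3
  refine ⟨ha, ?_⟩
  rw [ha] at h1
  simpa using h1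

theorem image_joinLine_eq_linesThrough [Infinite K] {F : MvPolynomial (Fin (n + 1)) K}
    (hF : F.IsHomogeneous 3) {p : ℙ K (Fin (n + 1) → K)} (hp : p ∈ hypersurface F)
    (h : IsComplementary φ p.rep) (hT : ∀ w, differential F p.rep (φ w) = 0)
    (hT' : ∀ u, differential F p.rep u = 0 → ∃ (s : K) (w : Fin N → K), u = s • p.rep + φ w) :
    joinLine h '' zeroLocus {pullback φ (polar F p.rep), pullback φ F} =
      linesThrough (hypersurface F) p := by
  have hp0 := rep_mem_hypersurface_iff.mp hp
  have hline : ∀ s t w, eval (s • p.rep + t • φ w) F =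
      s * t ^ 2 * eval w (pullback φ (polar F p.rep)) + t ^ 3 * eval w (pullback φ F) := by
    intro s t w
    rw [eval_smul_add_smul hF, hp0, hT, eval_pullback, eval_pullback, eval_polar]
    ring
  ext L
  constructor
  · rintro ⟨w, hw, rfl⟩
    have h1 := hw _ (Set.mem_insert _ _)
    have h2 := hw _ (Set.mem_insert_of_mem _ rfl)
    refine ⟨fun y hy => ?_, ?_⟩
    · have : y.rep ∈ Submodule.span K {p.rep, φ w.rep} := by
        refine hy ?_
        rw [Projectivization.submodule_eq]
        exact Submodule.mem_span_singleton_self _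
      obtain ⟨s, t, hst⟩ := Submodule.mem_span_pair.mp this
      rw [rep_mem_hypersurface_iff, ← hst, hline, h1, h2]
      ring
    · rw [Line.Contains, Projectivization.submodule_eq, Submodule.span_singleton_le_iff_mem]
      exact Submodule.subset_span (by simp)
  · rintro ⟨hLX, hpL⟩
    rw [Line.Contains, Projectivization.submodule_eq, Submodule.span_singleton_le_iff_mem] at hpL
    have hL0 : ∀ v ∈ L.1, eval v F = 0 := by
      intro v hv
      by_cases hv0 : v = 0
      · subst hv0
        have := eval_smul_of_isHomogeneous hF 0 (0 : Fin (n + 1) → K)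
        simpa using this
      · rw [← mk_mem_hypersurface_iff hF hv0]
        refine hLX _ ?_
        rwa [Line.Contains, Projectivization.submodule_mk, Submodule.span_singleton_le_iff_mem]
    obtain ⟨u, huL, hu⟩ : ∃ u ∈ L.1, u ∉ Submodule.span K {p.rep} := by
      by_contra hcon
      push Not at hcon
      have h1 := Submodule.finrank_mono (R := K) (show L.1 ≤ Submodule.span K {p.rep} from hcon)
      rw [L.2, finrank_span_singleton p.rep_nonzero] at h1
      omega
    -- The first coefficient shows that the line is tangent, so that `u` can be replaced by some `φ
    -- w` on the same line.
    have hcoef := eq_zero_of_cubic_coeffs (a := differential F p.rep u)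
      (b := differential F u p.rep) fun s => by
        have h1 := eval_smul_add_smul hF s 1 p.rep u
        rw [hL0 _ (L.1.add_mem (L.1.smul_mem s hpL) (L.1.smul_mem 1 huL)), hp0, hL0 u huL] at h1
        linear_combination -h1
    obtain ⟨s, w, rfl⟩ := hT' u hcoef.1
    have hw : w ≠ 0 := by
      rintro rfl
      refine hu (Submodule.mem_span_singleton.mpr ⟨s, by simp⟩)
    have hwL : φ w ∈ L.1 := by
      have := L.1.sub_mem huL (L.1.smul_mem s hpL)
      simpa using this
    have hcoef' := eq_zero_of_cubic_coeffs (a := differential F p.rep (φ w))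
      (b := differential F (φ w) p.rep) fun s => by
        have h1 := eval_smul_add_smul hF s 1 p.rep (φ w)
        rw [hL0 _ (L.1.add_mem (L.1.smul_mem s hpL) (L.1.smul_mem 1 hwL)), hp0, hL0 _ hwL] at h1
        linear_combination -h1
    refine ⟨Projectivization.mk K w hw, ?_, ?_⟩
    · rw [mk_mem_zeroLocus_iff]
      · rintro f (rfl | rfl)
        · rw [eval_pullback, eval_polar, hcoef'.2]
        · rw [eval_pullback, hL0 _ hwL]
      · rintro f (rfl | rfl)
        · exact ⟨2, isHomogeneous_pullback φ (isHomogeneous_polar hF _)⟩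
        · exact ⟨3, isHomogeneous_pullback φ hF⟩
    · apply Subtype.ext
      refine Submodule.eq_of_le_of_finrank_eq (Submodule.span_le.mpr ?_)
        ((joinLine h _).2.trans L.2.symm)
      obtain ⟨a, ha⟩ := Projectivization.exists_smul_eq_mk_rep K w hw
      rintro v (rfl | rfl)
      · exact hpL
      · rw [SetLike.mem_coe, ← ha, Units.smul_def, map_smul]
        exact L.1.smul_mem _ hwL

/-- A parametrised complement of a vector `x` in the kernel of a nonzero linear form. -/
theorem exists_isComplementary (hN : N + 1 = n) {x : Fin (n + 1) → K} (hx : x ≠ 0)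
    {l : (Fin (n + 1) → K) →ₗ[K] K} (hl : l ≠ 0) (hlx : l x = 0) :
    ∃ φ : (Fin N → K) →ₗ[K] (Fin (n + 1) → K), IsComplementary φ x ∧ (∀ w, l (φ w) = 0) ∧
      ∀ u, l u = 0 → ∃ (s : K) (w : Fin N → K), u = s • x + φ w := by
  obtain ⟨W', hW'⟩ := Submodule.exists_isCompl (Submodule.span K {x})
  have hxT : Submodule.span K {x} ≤ LinearMap.ker l := by
    rwa [Submodule.span_singleton_le_iff_mem, LinearMap.mem_ker]
  -- As `x` lies in the kernel, the modular law turns a complement of `x` in the whole space into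
  -- one in the kernel.
  set W := W' ⊓ LinearMap.ker l with hW
  have hsup : Submodule.span K {x} ⊔ W = LinearMap.ker l := by
    rw [hW, ← sup_inf_assoc_of_le _ hxT, hW'.sup_eq_top, top_inf_eq]
  have hinf : Submodule.span K {x} ⊓ W = ⊥ := by
    rw [hW, ← inf_assoc, hW'.inf_eq_bot, bot_inf_eq]
  have hker : Module.finrank K (LinearMap.ker l) = n := by
    have h1 := LinearMap.finrank_range_add_finrank_ker l
    have h2 : LinearMap.range l = ⊤ := LinearMap.range_eq_top.mpr (LinearMap.surjective hl)
    rw [h2, finrank_top, Module.finrank_self, Module.finrank_fin_fun] at h1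
    omega
  have hfin : Module.finrank K W = N := by
    have h1 := Submodule.finrank_sup_add_finrank_inf_eq (Submodule.span K {x}) W
    rw [hsup, hinf, hker, finrank_bot, finrank_span_singleton hx] at h1
    omega
  let b := Module.finBasisOfFinrankEq K W hfin
  refine ⟨W.subtype ∘ₗ b.equivFun.symm.toLinearMap, ?_, ?_, ?_⟩
  · intro s w hsw
    have hw : (b.equivFun.symm w : Fin (n + 1) → K) ∈ Submodule.span K {x} ⊓ W := by
      refine ⟨?_, Subtype.prop _⟩
      rw [SetLike.mem_coe, Submodule.mem_span_singleton]
      exact ⟨-s, by rw [neg_smul]; exact neg_eq_of_add_eq_zero_right hsw⟩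
    rw [hinf, Submodule.mem_bot] at hw
    have hw0 : w = 0 := b.equivFun.symm.map_eq_zero_iff.mp (Subtype.ext hw)
    refine ⟨?_, hw0⟩
    rw [hw0, map_zero, add_zero] at hsw
    exact (smul_eq_zero.mp hsw).resolve_right hx
  · intro w
    exact (b.equivFun.symm w).2.2
  · intro u hu
    have : u ∈ Submodule.span K {x} ⊔ W := by rw [hsup]; exact hu
    obtain ⟨y, hy, z, hz, rfl⟩ := Submodule.mem_sup.mp this
    obtain ⟨s, rfl⟩ := Submodule.mem_span_singleton.mp hy
    exact ⟨s, b.equivFun ⟨z, hz⟩, by simp⟩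

end LinesThroughPoint

/-! ### Smoothness excludes large linear subspaces. -/

section Smooth

variable {K : Type*} [Field K] {n : ℕ} {F : MvPolynomial (Fin (n + 1)) K}

theorem IsSmooth.differential_ne_zero (hs : IsSmooth F) {d : ℕ} (hF : F.IsHomogeneous d)
    {v : Fin (n + 1) → K} (hv : v ≠ 0) (h0 : eval v F = 0) : differential F v ≠ 0 := by
  intro hd
  obtain ⟨i, hi⟩ := hs _ ((mk_mem_hypersurface_iff hF hv).mpr h0)
  apply hi
  rw [eval_rep_mk_eq_zero_iff hF.pderiv]
  classical
  have := LinearMap.congr_fun hd (Pi.single i 1)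
  simpa [differential_apply, Pi.single_apply] using this

/-- A smooth cubic in `ℙⁿ`, `n ≥ 4`, contains no linear subspace of codimension `2`. -/
theorem IsSmooth.exists_eval_ne_zero [IsAlgClosed K] (hs : IsSmooth F) (hF : F.IsHomogeneous 3)
    (hn : 4 ≤ n) {Λ : Submodule K (Fin (n + 1) → K)} (hΛ : Module.finrank K Λ + 1 = n) :
    ∃ v ∈ Λ, eval v F ≠ 0 := by
  by_contra! hcon
  obtain ⟨M, hM⟩ := Submodule.exists_isCompl Λ
  have hMfin : Module.finrank K M = 2 := by
    have := Submodule.finrank_add_eq_of_isCompl hM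
    rw [Module.finrank_fin_fun] at this
    omega
  let e := Module.finBasisOfFinrankEq K M hMfin
  let b := Module.finBasis K Λ
  let φ : (Fin (Module.finrank K Λ) → K) →ₗ[K] (Fin (n + 1) → K) :=
    Λ.subtype ∘ₗ b.equivFun.symm.toLinearMap
  -- Derivatives along `Λ` vanish because `F` does; those in the two complementary directions are
  -- quadrics on `Λ`, of dimension `n - 1 ≥ 3`. A common zero is singular.
  obtain ⟨w, hw, h0, h1⟩ := exists_common_zero (by omega)
    (isHomogeneous_pullback φ (isHomogeneous_polar hF (e 0)))
    (isHomogeneous_pullback φ (isHomogeneous_polar hF (e 1))) two_ne_zero two_ne_zero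
  rw [eval_pullback, eval_polar] at h0 h1
  have hφ : Function.Injective φ := Λ.subtype_injective.comp b.equivFun.symm.injective
  have hv : φ w ≠ 0 := fun h => hw (hφ (h.trans (map_zero φ).symm))
  have hvΛ : φ w ∈ Λ := (b.equivFun.symm w).2
  refine hs.differential_ne_zero hF hv (hcon _ hvΛ) ?_
  rw [← LinearMap.ker_eq_top, eq_top_iff, ← hM.sup_eq_top, sup_le_iff]
  constructor
  · intro u hu
    refine (eq_zero_of_cubic_coeffs (a := differential F (φ w) u)
      (b := differential F u (φ w)) fun s => ?_).1
    have h2 := eval_smul_add_smul hF s 1 (φ w) u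
    rw [hcon _ (Λ.add_mem (Λ.smul_mem s hvΛ) (Λ.smul_mem 1 hu)), hcon _ hvΛ, hcon _ hu] at h2
    linear_combination -h2
  · intro u hu
    have h2 := congrArg Subtype.val (e.sum_repr ⟨u, hu⟩)
    simp only [Fin.sum_univ_two, Submodule.coe_add, Submodule.coe_smul] at h2
    rw [LinearMap.mem_ker, ← h2, map_add, map_smul, map_smul, h0, h1, smul_zero, smul_zero,
      add_zero]

end Smooth

end CubicLines

namespace CubicLines

attribute [local instance] MvPolynomial.gradedAlgebra

/-! ### Eckardt points form a closed set. -/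

section Eckardt

variable {K : Type*} [Field K] {n : ℕ} {F : MvPolynomial (Fin (n + 1)) K}

/-- For tangent `v`, `F(a x + v) = a dF_v(x) + F(v)` is affine in `a`. The cone condition says that
vanishing at one `a` implies vanishing at all, so the slope must be zero. -/
theorem isEckardtPoint_iff (hF : F.IsHomogeneous 3) {p : ℙ K (Fin (n + 1) → K)}
    (hp : p ∈ hypersurface F) :
    IsEckardtPoint F p ↔ ∀ v, differential F p.rep v = 0 → differential F v p.rep = 0 := by
  have hp0 := rep_mem_hypersurface_iff.mp hp
  have hpp : differential F p.rep p.rep = 0 := by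
    rw [differential_self hF, hp0, mul_zero]
  constructor
  · rintro ⟨-, -, hcone⟩ v hv
    by_contra hne
    have hne0 : ∀ a : K, a • p.rep + v ≠ 0 := by
      intro a ha
      have : v = (-a) • p.rep := by rw [neg_smul]; exact (neg_eq_of_add_eq_zero_right ha).symm
      rw [this, differential_smul_left hF, hpp, mul_zero] at hne
      exact hne rfl
    have hT : ∀ a : K, Projectivization.mk K _ (hne0 a) ∈ tangentSpace F p := by
      intro a
      rw [mk_mem_tangentSpace_iff, map_add, map_smul, hpp, hv, smul_zero, add_zero]
    have heval : ∀ a : K, eval (a • p.rep + v) F = a * differential F v p.rep + eval v F := by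
      intro a
      have h := eval_smul_add_smul hF a 1 p.rep v
      rw [one_smul, hp0, hv] at h
      rw [h]
      ring
    have hX : ∀ a : K, Projectivization.mk K _ (hne0 a) ∈ hypersurface F ↔
        a * differential F v p.rep + eval v F = 0 := by
      intro a
      rw [mk_mem_hypersurface_iff hF, heval]
    -- The unique root when the slope is nonzero; the cone would also contain the point with
    -- parameter `a + 1`.
    set a := -eval v F / differential F v p.rep with ha
    have ha0 : a * differential F v p.rep + eval v F = 0 := by
      rw [ha, div_mul_cancel₀ _ hne, neg_add_cancel]
    have h1 := hcone _ ⟨(hX a).mpr ha0, hT a⟩ (Projectivization.mk K _ (hne0 (a + 1))) (by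
      rw [Projectivization.submodule_mk, Projectivization.submodule_mk,
        Projectivization.submodule_eq, Submodule.span_singleton_le_iff_mem]
      have : (a + 1) • p.rep + v = p.rep + (a • p.rep + v) := by
        rw [add_smul, one_smul]
        abel
      rw [this]
      exact Submodule.add_mem_sup (Submodule.mem_span_singleton_self _)
        (Submodule.mem_span_singleton_self _))
    have h2 := (hX (a + 1)).mp h1.1
    apply hne
    linear_combination h2 - ha0
  · intro h
    refine ⟨hp, ⟨hp, mem_tangentSpace_iff.mpr hpp⟩, ?_⟩
    rintro y ⟨hyX, hyT⟩ z hz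
    rw [mem_tangentSpace_iff] at hyT
    have hz' : z.rep ∈ p.submodule ⊔ y.submodule := by
      refine hz ?_
      rw [Projectivization.submodule_eq]
      exact Submodule.mem_span_singleton_self _
    rw [Projectivization.submodule_eq p, Projectivization.submodule_eq y,
      ← Submodule.span_union, Set.singleton_union] at hz'
    obtain ⟨s, t, hst⟩ := Submodule.mem_span_pair.mp hz'
    constructor
    · rw [rep_mem_hypersurface_iff, ← hst, eval_smul_add_smul hF, hp0, hyT, h _ hyT,
        rep_mem_hypersurface_iff.mp hyX]
      ring
    · rw [mem_tangentSpace_iff, ← hst, map_add, map_smul, map_smul, hpp, hyT, smul_zero, smul_zero,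
        add_zero]

/-- The quintic form `x ↦ dF_v(x)`, where `v = (∂F/∂xᵢ)(x) w - dF_x(w) eᵢ` runs through
tangent vectors at `x`. -/
noncomputable def eckardtForm (F : MvPolynomial (Fin (n + 1)) K) (i : Fin (n + 1))
    (w : Fin (n + 1) → K) : MvPolynomial (Fin (n + 1)) K :=
  ∑ k, X k * aeval (fun j => C (w j) * pderiv i F - polar F w * C (Pi.single (M := fun _ => K) i 1 j)) (pderiv k F)

theorem isHomogeneous_eckardtForm (hF : F.IsHomogeneous 3) (i : Fin (n + 1))
    (w : Fin (n + 1) → K) : (eckardtForm F i w).IsHomogeneous 5 := by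
  refine IsHomogeneous.sum _ _ _ fun k _ => ?_
  refine (isHomogeneous_X K k).mul (n := 2 * 2) (hF.pderiv.aeval _ fun j => ?_)
  refine (hF.pderiv.C_mul _).sub ?_
  rw [mul_comm]
  exact (isHomogeneous_polar hF w).C_mul _

theorem eval_eckardtForm (F : MvPolynomial (Fin (n + 1)) K) (i : Fin (n + 1))
    (x w : Fin (n + 1) → K) : eval x (eckardtForm F i w) =
      differential F (eval x (pderiv i F) • w - differential F x w • (Pi.single i 1 : Fin (n + 1) → K)) x := by
  rw [eckardtForm, map_sum, differential_apply]
  refine Finset.sum_congr rfl fun k _ => ?_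
  rw [map_mul, eval_X, mul_comm]
  congr 1
  have : ((aeval x : MvPolynomial (Fin (n + 1)) K →ₐ[K] K).comp
      (aeval (fun j => C (w j) * pderiv i F - polar F w * C (Pi.single (M := fun _ => K) i 1 j)))) =
      aeval (eval x (pderiv i F) • w - differential F x w • (Pi.single i 1 : Fin (n + 1) → K)) := by
    apply MvPolynomial.algHom_ext
    intro j
    simp [aeval_eq_eval, eval_polar, mul_comm]
  have := AlgHom.congr_fun this (pderiv k F)
  simpa [aeval_eq_eval] using this

theorem isClosed_eckardt (hF : F.IsHomogeneous 3) (hs : IsSmooth F) :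
    IsClosed {x : hypersurface F | IsEckardtPoint F x.1} := by
  have hcl : IsClosed (zeroLocus {f | ∃ i w, f = eckardtForm F i w}) :=
    isClosed_iff.mpr ⟨_, by
      rintro _ ⟨i, w, rfl⟩
      exact ⟨5, isHomogeneous_eckardtForm hF i w⟩, rfl⟩
  convert hcl.preimage (continuous_subtype_val (p := fun x => x ∈ hypersurface F)) using 1
  ext ⟨p, hp⟩
  rw [Set.mem_ofPred_eq, isEckardtPoint_iff hF hp, Set.mem_preimage]
  classical
  have hsingle : ∀ i, differential F p.rep (Pi.single i 1) = eval p.rep (pderiv i F) := by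
    intro i
    simp [differential_apply, Pi.single_apply]
  constructor
  · rintro h _ ⟨i, w, rfl⟩
    rw [eval_eckardtForm]
    apply h
    rw [map_sub, map_smul, map_smul, hsingle, smul_eq_mul, smul_eq_mul]
    ring
  · intro h v hv
    obtain ⟨i, hi⟩ := hs p hp
    have h1 := h _ ⟨i, v, rfl⟩
    -- For tangent `v` the quintic equals `(∂F/∂xᵢ)² dF_v(x)`, and smoothness supplied `i` with
    -- nonzero partial derivative.
    rw [eval_eckardtForm, hv, zero_smul, sub_zero, differential_smul_left hF, mul_eq_zero] at h1
    exact h1.resolve_left (pow_ne_zero _ hi)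

end Eckardt

/-! ### The quadric and the cubic share no factor. -/

section CommonFactor

variable {K : Type*} [Field K]

theorem exists_linearMap_of_isHomogeneous_one {N : ℕ} {p : MvPolynomial (Fin N) K}
    (hp : p.IsHomogeneous 1) : ∃ l : (Fin N → K) →ₗ[K] K, ∀ v, l v = eval v p :=
  ⟨differential p 0, differential_linear hp 0⟩

variable {n N : ℕ} {F : MvPolynomial (Fin (n + 1)) K}
  {φ : (Fin N → K) →ₗ[K] (Fin (n + 1) → K)} {x : Fin (n + 1) → K}

theorem IsComplementary.injective (h : IsComplementary φ x) : Function.Injective φ := by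
  rw [← LinearMap.ker_eq_bot, LinearMap.ker_eq_bot']
  intro w hw
  exact (h 0 w (by rw [hw, zero_smul, add_zero])).2

/-- The graph of `l` over the complement has dimension `N = n - 1`, so it cannot lie in the cubic.
-/
theorem IsComplementary.exists_eval_graph_ne_zero [IsAlgClosed K] (h : IsComplementary φ x)
    (hs : IsSmooth F) (hF : F.IsHomogeneous 3) (hn : 4 ≤ n) (hN : N + 1 = n)
    (l : (Fin N → K) →ₗ[K] K) : ∃ w, eval (l w • x + φ w) F ≠ 0 := by
  let g : (Fin N → K) →ₗ[K] (Fin (n + 1) → K) := l.smulRight x + φ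
  have hg : Function.Injective g := by
    rw [← LinearMap.ker_eq_bot, LinearMap.ker_eq_bot']
    intro w hw
    exact (h (l w) w hw).2
  obtain ⟨_, ⟨w, rfl⟩, hw⟩ := hs.exists_eval_ne_zero hF hn (Λ := LinearMap.range g) (by
    rw [LinearMap.finrank_range_of_inj hg, Module.finrank_fin_fun, hN])
  exact ⟨w, hw⟩

/-- The span of `x` and the image of the hyperplane `l = 0` has dimension `1 + (N - 1) = n - 1`. -/
theorem IsComplementary.exists_eval_ker_ne_zero [IsAlgClosed K] (h : IsComplementary φ x)
    (hs : IsSmooth F) (hF : F.IsHomogeneous 3) (hn : 4 ≤ n) (hN : N + 1 = n)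
    {l : (Fin N → K) →ₗ[K] K} (hl : l ≠ 0) : ∃ (s : K) (w : Fin N → K), l w = 0 ∧ eval (s • x + φ w) F ≠ 0 := by
  let g : K × LinearMap.ker l →ₗ[K] (Fin (n + 1) → K) :=
    (LinearMap.toSpanSingleton K _ x).coprod (φ ∘ₗ (LinearMap.ker l).subtype)
  have hg : Function.Injective g := by
    rw [← LinearMap.ker_eq_bot, LinearMap.ker_eq_bot']
    rintro ⟨s, w⟩ hw
    obtain ⟨h1, h2⟩ := h s w.1 hw
    exact Prod.ext h1 (Subtype.ext h2)
  have hker : Module.finrank K (LinearMap.ker l) + 1 = N := by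
    have h1 := LinearMap.finrank_range_add_finrank_ker l
    have h2 : LinearMap.range l = ⊤ := LinearMap.range_eq_top.mpr (LinearMap.surjective hl)
    rw [h2, finrank_top, Module.finrank_self, Module.finrank_fin_fun] at h1
    omega
  obtain ⟨_, ⟨⟨s, w⟩, rfl⟩, hw⟩ := hs.exists_eval_ne_zero hF hn (Λ := LinearMap.range g) (by
    rw [LinearMap.finrank_range_of_inj hg, Module.finrank_prod, Module.finrank_self]
    omega)
  exact ⟨s, w.1, w.2, hw⟩

/-- The quadric and the cubic that cut out the lines through a point of a smooth cubic have no
common factor. -/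
theorem IsComplementary.not_dvd [IsAlgClosed K] (h : IsComplementary φ x)
    (hs : IsSmooth F) (hF : F.IsHomogeneous 3) (hn : 4 ≤ n) (hN : N + 1 = n)
    {q c : MvPolynomial (Fin N) K} (hc : c.IsHomogeneous 3) (hq : q.IsHomogeneous 2) (hq0 : q ≠ 0)
    (hline : ∀ s w, eval (s • x + φ w) F = s * eval w q + eval w c)
    (p : MvPolynomial (Fin N) K) (d : ℕ) (hp : p.IsHomogeneous d) (hirr : Irreducible p)
    (hpq : p ∣ q) : ¬ p ∣ c := by
  rintro ⟨m, hm⟩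
  obtain ⟨r, hr⟩ := hpq
  have hr0 : r ≠ 0 := by
    rintro rfl
    exact hq0 (by rw [hr, mul_zero])
  have hdeg := totalDegree_mul_of_isDomain hirr.ne_zero hr0
  rw [← hr, hq.totalDegree hq0, hp.totalDegree hirr.ne_zero] at hdeg
  have hd0 := hp.ne_zero_of_irreducible hirr
  obtain rfl | rfl : d = 1 ∨ d = 2 := by omega
  -- A linear common factor makes `F` vanish on the span of `x` and the hyperplane `p = 0`.
  · obtain ⟨l, hl⟩ := exists_linearMap_of_isHomogeneous_one hp
    have hl0 : l ≠ 0 := by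
      rintro rfl
      exact hirr.ne_zero (MvPolynomial.funext fun v => by rw [← hl, map_zero]; rfl)
    obtain ⟨s, w, hw, hne⟩ := h.exists_eval_ker_ne_zero hs hF hn hN hl0
    rw [hl] at hw
    apply hne
    rw [hline, hr, hm, map_mul, map_mul, hw]
    ring
  -- Here `q = a p` and `c = p m₁` with `m₁` linear, so `F(s x + φ w) = p(w) (a s + m₁(w))` vanishes
  -- on the graph `s = -m₁(w) / a`.
  · have hrC := totalDegree_eq_zero_iff_eq_C.mp (show r.totalDegree = 0 by omega)
    set a := coeff 0 r
    have ha : a ≠ 0 := by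
      intro ha
      rw [ha, C_0] at hrC
      exact hr0 hrC
    have hm1 : c = p * homogeneousComponent 1 m := by
      have h1 := DirectSum.coe_decompose_mul_add_of_left_mem (homogeneousSubmodule (Fin N) K)
        (i := 2) (j := 1) (b := m) ((mem_homogeneousSubmodule 2 p).mpr hp)
      rw [← hm] at h1
      have h2 : ∀ (f : MvPolynomial (Fin N) K) i,
          ((DirectSum.decompose (homogeneousSubmodule (Fin N) K) f i :
            homogeneousSubmodule (Fin N) K i) : MvPolynomial (Fin N) K) =
              homogeneousComponent i f := fun f i => decomposition.decompose'_apply f i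
      rw [h2, h2, homogeneousComponent_eq_self hc] at h1
      exact h1
    obtain ⟨l, hl⟩ := exists_linearMap_of_isHomogeneous_one (homogeneousComponent_isHomogeneous 1 m)
    obtain ⟨w, hw⟩ := h.exists_eval_graph_ne_zero hs hF hn hN (-a⁻¹ • l)
    apply hw
    rw [hline, hm1, hr, map_mul, map_mul, hrC, eval_C, LinearMap.smul_apply, hl, smul_eq_mul]
    field_simp
    ring

end CommonFactor

/-! ### Dimensions at ordinary points and at Eckardt points. -/

section LinesOnSmoothCubic

variable {K : Type*} [Field K] {n N : ℕ} {F : MvPolynomial (Fin (n + 1)) K}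
  {φ : (Fin N → K) →ₗ[K] (Fin (n + 1) → K)} {p : ℙ K (Fin (n + 1) → K)}

theorem eval_line (hF : F.IsHomogeneous 3) (hp : p ∈ hypersurface F) {v : Fin (n + 1) → K}
    (hv : differential F p.rep v = 0) (s : K) :
    eval (s • p.rep + v) F = s * differential F v p.rep + eval v F := by
  have h := eval_smul_add_smul hF s 1 p.rep v
  rw [one_smul, rep_mem_hypersurface_iff.mp hp, hv] at h
  rw [h]
  ring

theorem isEckardtPoint_iff_pullback_polar [Infinite K] (hF : F.IsHomogeneous 3)
    (hp : p ∈ hypersurface F) (hT : ∀ w, differential F p.rep (φ w) = 0)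
    (hT' : ∀ u, differential F p.rep u = 0 → ∃ (s : K) (w : Fin N → K), u = s • p.rep + φ w) :
    IsEckardtPoint F p ↔ pullback φ (polar F p.rep) = 0 := by
  rw [isEckardtPoint_iff hF hp]
  constructor
  · intro h
    apply MvPolynomial.funext
    intro w
    rw [eval_pullback, eval_polar, h _ (hT w), map_zero]
  · intro h v hv
    obtain ⟨s, w, rfl⟩ := hT' v hv
    have hw : differential F (φ w) p.rep = 0 := by
      rw [← eval_polar, ← eval_pullback, h, map_zero]
    -- Write `v = s x + φ w`. Computing `F(x + v)` from base vector `φ w` and from base vector `v`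
    -- isolates `dF_v(x)`.
    have h0 := eval_line hF hp (hT w) s
    have h1 := eval_line hF hp (hT w) (1 + s)
    have h2 := eval_line hF hp hv 1
    rw [← add_assoc, ← add_smul, h1, h0, hw] at h2
    linear_combination -h2

variable [IsAlgClosed K]

/-- Away from the Eckardt points, the lines through a point of a smooth cubic in `ℙⁿ` form a
family of dimension `n - 4`. -/
theorem topologicalKrullDim_linesThrough {d : ℕ} (hd : d + 4 = n) (hF : F.IsHomogeneous 3)
    (hs : IsSmooth F) (hp : p ∈ hypersurface F) (hE : ¬ IsEckardtPoint F p) :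
    topologicalKrullDim (linesThrough (hypersurface F) p) = d := by
  have hp0 := rep_mem_hypersurface_iff.mp hp
  obtain ⟨φ, h, hT, hT'⟩ := exists_isComplementary (N := d + 3) hd p.rep_nonzero
    (hs.differential_ne_zero hF p.rep_nonzero hp0)
    (by rw [differential_self hF, hp0, mul_zero])
  have hq := isHomogeneous_pullback φ (isHomogeneous_polar hF p.rep)
  have hc := isHomogeneous_pullback φ hF
  have hq0 := (isEckardtPoint_iff_pullback_polar hF hp hT hT').not.mp hE
  rw [← image_joinLine_eq_linesThrough hF hp h hT hT',
    ← ((isEmbedding_joinLine h).homeomorphImage _).isHomeomorph.topologicalKrullDim_eq,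
    ← CubicLines.zeroLocus_span, topologicalKrullDim_zeroLocus,
    krullDim_relevantPrimes_pair rfl hq hc two_ne_zero three_ne_zero hq0]
  · refine h.not_dvd hs hF (by omega) hd hc hq hq0 fun s w => ?_
    rw [eval_line hF hp (hT w), eval_pullback, eval_pullback, eval_polar]
  · apply isHomogeneous_span
    rintro _ (rfl | rfl)
    exacts [⟨2, hq⟩, ⟨3, hc⟩]
  · rw [Ideal.span_le]
    rintro _ (rfl | rfl)
    exacts [mem_idealOfVars_of_isHomogeneous hq two_ne_zero,
      mem_idealOfVars_of_isHomogeneous hc three_ne_zero]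

/-- At an Eckardt point, the lines on the cubic form a cone over a cubic in `ℙⁿ⁻²`. -/
theorem IsEckardtPoint.exists_homeomorph {d : ℕ} (hd : d + 3 = n) (hn : 4 ≤ n)
    (hF : F.IsHomogeneous 3) (hs : IsSmooth F) (hE : IsEckardtPoint F p) :
    ∃ c : MvPolynomial (Fin (d + 2)) K, c.IsHomogeneous 3 ∧ c ≠ 0 ∧
      Nonempty (zeroLocus (Ideal.span {c} : Set (MvPolynomial (Fin (d + 2)) K)) ≃ₜ
        linesThrough (hypersurface F) p) := by
  have hp := hE.1
  have hp0 := rep_mem_hypersurface_iff.mp hp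
  obtain ⟨φ, h, hT, hT'⟩ := exists_isComplementary (N := d + 2) hd p.rep_nonzero
    (hs.differential_ne_zero hF p.rep_nonzero hp0)
    (by rw [differential_self hF, hp0, mul_zero])
  have hq0 := (isEckardtPoint_iff_pullback_polar hF hp hT hT').mp hE
  refine ⟨pullback φ F, isHomogeneous_pullback φ hF, fun hc0 => ?_, ?_⟩
  -- The graph of the zero form is the image of `φ`, on which `F` would vanish if `c = 0`.
  · obtain ⟨w, hw⟩ := h.exists_eval_graph_ne_zero hs hF hn hd 0
    apply hw
    rw [LinearMap.zero_apply, zero_smul, zero_add, ← eval_pullback, hc0, map_zero]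
  · rw [← image_joinLine_eq_linesThrough hF hp h hT hT', hq0,
      ← CubicLines.zeroLocus_span {0, pullback φ F}, Ideal.span_insert_zero]
    exact ⟨(isEmbedding_joinLine h).homeomorphImage _⟩

theorem IsEckardtPoint.linesThrough_nonempty (hn : 4 ≤ n) (hF : F.IsHomogeneous 3)
    (hs : IsSmooth F) (hE : IsEckardtPoint F p) : (linesThrough (hypersurface F) p).Nonempty := by
  obtain ⟨d, rfl⟩ : ∃ d, d + 3 = n := ⟨n - 3, by omega⟩
  obtain ⟨c, hc, -, ⟨e⟩⟩ := hE.exists_homeomorph rfl hn hF hs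
  obtain ⟨v, hv, hvc, -⟩ := exists_common_zero (by omega) hc hc three_ne_zero three_ne_zero
  have : Projectivization.mk K v hv ∈
      zeroLocus (Ideal.span {c} : Set (MvPolynomial (Fin (d + 2)) K)) := by
    rw [CubicLines.zeroLocus_span, mk_mem_zeroLocus_iff (by rintro _ rfl; exact ⟨3, hc⟩)]
    rintro _ rfl
    exact hvc
  exact ⟨_, (e ⟨_, this⟩).2⟩

theorem IsEckardtPoint.topologicalKrullDim_irreducibleComponent {d : ℕ} (hd : d + 3 = n)
    (hn : 4 ≤ n) (hF : F.IsHomogeneous 3) (hs : IsSmooth F) (hE : IsEckardtPoint F p)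
    {Z : Set (linesThrough (hypersurface F) p)} (hZ : Z ∈ irreducibleComponents _) :
    topologicalKrullDim Z = d := by
  obtain ⟨c, hc, hc0, ⟨e⟩⟩ := hE.exists_homeomorph hd hn hF hs
  have hZ' := preimage_mem_irreducibleComponents hZ e.isOpenEmbedding (by
    rw [e.surjective.range_eq, Set.inter_univ]
    exact hZ.1.nonempty)
  have hhom : (Ideal.span {c}).IsHomogeneous (homogeneousSubmodule (Fin (d + 2)) K) :=
    isHomogeneous_span (by rintro _ rfl; exact ⟨3, hc⟩)
  have hle : Ideal.span {c} ≤ idealOfVars (Fin (d + 2)) K :=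
    (Ideal.span_singleton_le_iff_mem _).mpr (mem_idealOfVars_of_isHomogeneous hc three_ne_zero)
  obtain ⟨P, hP, hdim⟩ := exists_minimalPrimes_of_mem_irreducibleComponents hhom hle hZ'
  rw [krullDim_relevantPrimes_of_mem_minimalPrimes rfl hc hc0 hP] at hdim
  have h1 := (e.isEmbedding.homeomorphImage (e ⁻¹' Z)).isHomeomorph.topologicalKrullDim_eq
  rw [Set.image_preimage_eq Z e.surjective] at h1
  rw [← h1, hdim]

end LinesOnSmoothCubic

end CubicLines

theorem proposition4p2 {K : Type*} [Field K] [IsAlgClosed K] (n : ℕ) (hn : 4 ≤ n)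
    (F : MvPolynomial (Fin (n + 1)) K) (hF : F.IsHomogeneous 3) (hsmooth : CubicLines.IsSmooth F) :
    ∃ U : Set (CubicLines.hypersurface F),
      IsOpen U ∧
      (∀ x ∈ U, topologicalKrullDim
          (CubicLines.linesThrough (CubicLines.hypersurface F) x.1) = ((n - 4 : ℕ) : WithBot ℕ∞)) ∧
      (∀ x ∉ U, (CubicLines.linesThrough (CubicLines.hypersurface F) x.1).Nonempty ∧
        ∀ Z ∈ irreducibleComponents (CubicLines.linesThrough (CubicLines.hypersurface F) x.1),
          topologicalKrullDim Z = ((n - 3 : ℕ) : WithBot ℕ∞)) ∧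
      (∀ x, x ∉ U ↔ CubicLines.IsEckardtPoint F x.1) := by
  refine ⟨{x | CubicLines.IsEckardtPoint F x.1}ᶜ,
    (CubicLines.isClosed_eckardt hF hsmooth).isOpen_compl, fun x hx => ?_, fun x hx => ?_,
    fun x => by simp⟩
  · exact CubicLines.topologicalKrullDim_linesThrough (by omega) hF hsmooth x.2 hx
  · rw [Set.notMem_compl_iff] at hx
    exact ⟨hx.linesThrough_nonempty hn hF hsmooth,
      fun Z hZ => hx.topologicalKrullDim_irreducibleComponent (by omega) hn hF hsmooth hZ⟩
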